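/- Let $G$ be a compact connected simple Lie group, realized as a closed subgroup of some $GL_n(\mathbb R)$, with Lie algebra $\mathfrak g$, and let $B$ be the negative of the Killing form of $\mathfrak g$. Let $\mathfrak t\subset\mathfrak g$ be a maximal abelian subalgebra, $\Pi$ a basis of simple roots of $(\mathfrak g^{\mathbb C},\mathfrak t^{\mathbb C})$ and $\alpha_{i_0}\in\Pi$. Suppose that one of the following holds. * **$G_2(2)$:** $\mathfrak g^{\mathbb C}$ is of type $G_2$ and $\alpha_{i_0}$ is the short simple root. * **$E_8(8)$:** $\mathfrak g^{\mathbb C}$ is of type $E_8$ and $\alpha_{i_0}$ is the simple root at the end of the arm of length one of the Dynkin diagram (the simple root whose removal leaves a diagram of type $A_7$). In both cases $\alpha_{i_0}$ has coefficient $3$ in the highest root. Let $\mathfrak k$ be the subalgebra of $\mathfrak g$ whose complexification is the sum of $\mathfrak t^{\mathbb C}$ and the root spaces of all roots in which $\alpha_{i_0}$ has coefficient $0$. Let $\mathfrak k_0$ be the centre of $\mathfrak k$ and $\mathfrak k_1=[\mathfrak k,\mathfrak k]$, so that $\mathfrak k_0\cong\mathfrak u_1$, and $\mathfrak k_1\cong\mathfrak{su}_2$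 for $G_2(2)$, $\mathfrak k_1\cong\mathfrak{su}_8$ for $E_8(8)$. For $j=1,2,3$ let $\mathfrak p_j\subset\mathfrak g$ be the subspace whose complexification is the sum of the root spaces of all roots in which $\alpha_{i_0}$ has coefficient $\pm j$. Then $\mathfrak g=\mathfrak k_0\oplus\mathfrak k_1\oplus\mathfrak p_1\oplus\mathfrak p_2\oplus\mathfrak p_3$. For $u_0,u_1,x_1,x_2,x_3>0$ consider the left-invariant metric on $G$ given on $\mathfrak g=T_eG$ by the inner product $$\langle\ ,\ \rangle=u_0B|_{\mathfrak k_0}+u_1B|_{\mathfrak k_1}+x_1B|_{\mathfrak p_1}+x_2B|_{\mathfrak p_2}+x_3B|_{\mathfrak p_3},$$ with distinct summands orthogonal. For a closed subgroup $L\subset G$ with Lie algebra $\mathfrak l$, let $G\times L$ act on $G$ by $(a,h)\,y=ayh^{-1}$. The metric is called *naturally reductive with respect to $G\times L$* if it is $\mathrm{Ad}(L)$-invariant and the isotropy algebra $\Delta(\mathfrak l)=\{(X,X):X\in\mathfrak l\}$ of the identity has a complement $\mathfrak m$ in $\mathfrak g\oplus\mathfrak l$, invariant under $\mathrm{Ad}(h,h)$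 for all $h\in L$, such that $$\langle[p,q]_{\mathfrak m},r\rangle+\langle q,[p,r]_{\mathfrak m}\rangle=0\qquad\text{for all }p,q,r\in\mathfrak m.$$ Here $[\ ,\ ]_{\mathfrak m}$ is the component in $\mathfrak m$ along $\Delta(\mathfrak l)$, and $\mathfrak m$ is identified with $\mathfrak g$ by $(X,Y)\mapsto X-Y$. Then the metric is naturally reductive with respect to $G\times L$ for some closed subgroup $L$ of $G$ if and only if one of the following conditions holds: 1. $u_0=x_2$ and $x_1=x_3$ in the case $G_2(2)$; respectively $u_0=u_1=x_2$ and $x_1=x_3$ in the case $E_8(8)$; 2. $u_0=u_1=x_3$ and $x_1=x_2$; 3. $x_1=x_2=x_3$. -/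

import Mathlib

open scoped TensorProduct

/- The commutator bracket on an associative ring, here on square matrices. -/
attribute [local instance] LieRing.ofAssociativeRing

namespace NatRed

/-! ### Compact matrix Lie groups, their Lie algebras and the adjoint representation -/

section Groups

variable {n : ℕ}

/-- `𝔤` is the Lie algebra of the (closed) linear group `G ⊆ GL(n, ℝ)`:
it consists of the matrices `X` whose one-parameter group `t ↦ exp (t X)` lies in `G`. -/
def IsLieAlgebraOf (G : Subgroup (GL (Fin n) ℝ))
    (𝔤 : LieSubalgebra ℝ (Matrix (Fin n) (Fin n) ℝ)) : Prop :=
  ∀ X : Matrix (Fin n) (Fin n) ℝ,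
    X ∈ 𝔤 ↔ ∀ t : ℝ, ∃ g ∈ G, (g : Matrix (Fin n) (Fin n) ℝ) = NormedSpace.exp (t • X)

variable {G : Subgroup (GL (Fin n) ℝ)} {𝔤 : LieSubalgebra ℝ (Matrix (Fin n) (Fin n) ℝ)}

theorem IsLieAlgebraOf.conj_mem (hG : IsLieAlgebraOf G 𝔤) (g : G) (X : 𝔤) :
    ((g : GL (Fin n) ℝ) : Matrix (Fin n) (Fin n) ℝ) * (X : Matrix (Fin n) (Fin n) ℝ) *
      (((g : GL (Fin n) ℝ)⁻¹ : GL (Fin n) ℝ) : Matrix (Fin n) (Fin n) ℝ) ∈ 𝔤 := by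
  rw [hG]
  intro t
  obtain ⟨h, hh, he⟩ := (hG X).1 X.2 t
  refine ⟨g * h * (g : GL (Fin n) ℝ)⁻¹, G.mul_mem (G.mul_mem g.2 hh) (G.inv_mem g.2), ?_⟩
  have := Matrix.exp_units_conj (g : GL (Fin n) ℝ) (t • (X : Matrix (Fin n) (Fin n) ℝ))
  rw [← he] at this
  simp only [Matrix.mul_smul, Matrix.smul_mul] at this
  rw [this]
  rfl

/-- The adjoint representation `Ad(g) X = g X g⁻¹` of `G` on its Lie algebra. -/
def Ad (hG : IsLieAlgebraOf G 𝔤) (g : G) (X : 𝔤) : 𝔤 :=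
  ⟨_, hG.conj_mem g X⟩

/-- The diagonal `Δ(𝔩) = {(X, X) : X ∈ 𝔩}` in `𝔤 × 𝔤`. -/
def diagonal (𝔩 : LieSubalgebra ℝ 𝔤) : Submodule ℝ (𝔤 × 𝔤) :=
  𝔩.toSubmodule.map (LinearMap.prod LinearMap.id LinearMap.id)

/-- The differential at the identity of the orbit map `(a, h) ↦ a h⁻¹` of the action
`(a, h) y = a y h⁻¹`: the linear map `(X, Y) ↦ X - Y`. -/
def orbitDiff (p : 𝔤 × 𝔤) : 𝔤 := p.1 - p.2

/-- The left-invariant metric on `G` given by the inner product `m` on `𝔤 = T_e G` is naturally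
reductive with respect to the action `(a, h) y = a y h⁻¹` of `G × L` on `G`, where `L` is a
subgroup of `G`.

* `G × L` acts by isometries, i.e. `m` is `Ad(L)`-invariant;
* with `𝔩` the Lie algebra of `L`, the isotropy algebra `Δ(𝔩)` of the identity has an
  `Ad(ΔL)`-invariant complement `𝔪` in `𝔤 ⊕ 𝔩`;
* `⟨[p, q]_𝔪, r⟩ + ⟨q, [p, r]_𝔪⟩ = 0` for all `p, q, r ∈ 𝔪`, where `[·, ·]_𝔪` is the component
  in `𝔪` along `Δ(𝔩)`, and `𝔪` carries the metric transported by `orbitDiff : 𝔪 ≃ 𝔤`. As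
  `orbitDiff` vanishes on `Δ(𝔩)`, it takes the same value at `[p, q]_𝔪` and at `[p, q]`. -/
def IsNaturallyReductive (hG : IsLieAlgebraOf G 𝔤) (m : LinearMap.BilinForm ℝ 𝔤)
    (L : Subgroup G) : Prop :=
  (∀ h ∈ L, ∀ X Y : 𝔤, m (Ad hG h X) (Ad hG h Y) = m X Y) ∧
  ∃ 𝔩 : LieSubalgebra ℝ 𝔤, IsLieAlgebraOf (L.map G.subtype) (𝔩.map 𝔤.incl) ∧
    ∃ 𝔪 : Submodule ℝ (𝔤 × 𝔤),
      Disjoint (diagonal 𝔩) 𝔪 ∧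
      diagonal 𝔩 ⊔ 𝔪 = Submodule.prod ⊤ 𝔩.toSubmodule ∧
      (∀ h ∈ L, ∀ p ∈ 𝔪, (Ad hG h p.1, Ad hG h p.2) ∈ 𝔪) ∧
      ∀ p ∈ 𝔪, ∀ q ∈ 𝔪, ∀ r ∈ 𝔪,
        m (orbitDiff ⁅p, q⁆) (orbitDiff r) + m (orbitDiff q) (orbitDiff ⁅p, r⁆) = 0

end Groups

/-! ### The decomposition attached to a painted Dynkin diagram -/

section Roots

variable {𝔤 : Type*} [LieRing 𝔤] [LieAlgebra ℝ 𝔤] [Module.Finite ℝ 𝔤]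

/-- The complexification of a real Lie algebra with nondegenerate Killing form
has nondegenerate Killing form. -/
instance isKilling_complexification [LieAlgebra.IsKilling ℝ 𝔤] :
    LieAlgebra.IsKilling ℂ (ℂ ⊗[ℝ] 𝔤) where
  killingCompl_top_eq_bot := by
    have hnd := LieAlgebra.IsKilling.killingForm_nondegenerate ℝ 𝔤
    let v := Module.finBasis ℝ 𝔤
    have hdet := (LinearMap.BilinForm.nondegenerate_iff_det_ne_zero v).1 hnd
    have key : (killingForm ℂ (ℂ ⊗[ℝ] 𝔤)).Nondegenerate := by
      rw [LinearMap.BilinForm.nondegenerate_iff_det_ne_zero (v.baseChange ℂ)]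
      have : (LinearMap.BilinForm.toMatrix (v.baseChange ℂ)) (killingForm ℂ (ℂ ⊗[ℝ] 𝔤)) =
          ((LinearMap.BilinForm.toMatrix v) (killingForm ℝ 𝔤)).map (algebraMap ℝ ℂ) := by
        ext i j
        rw [killingForm, LieModule.traceForm_baseChange]
        simp [LinearMap.BilinForm.toMatrix_apply]
      rw [this, ← RingHom.mapMatrix_apply, ← RingHom.map_det]
      exact (map_ne_zero _).2 hdet
    rw [eq_bot_iff]
    intro x hx
    rw [LieIdeal.mem_killingCompl] at hx
    exact (LieSubmodule.mem_bot x).2 (key.2 x fun y ↦ hx y (LieSubmodule.mem_top y))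

variable [LieAlgebra.IsKilling ℝ 𝔤]
  {H : LieSubalgebra ℂ (ℂ ⊗[ℝ] 𝔤)} [H.IsCartanSubalgebra]

/-- The base `b` of the root system of `(𝔤ᶜ, H)` has Cartan matrix `A` (up to a numbering of the
simple roots), and the simple root `i₀` (the one painted black) is the one with number `k`. -/
def IsPaintedDiagram {ℓ : ℕ} (b : (LieAlgebra.IsKilling.rootSystem H).Base) (i₀ : b.support)
    (A : Matrix (Fin ℓ) (Fin ℓ) ℤ) (k : Fin ℓ) : Prop :=
  ∃ e : b.support ≃ Fin ℓ, (∀ i j, b.cartanMatrix i j = A (e i) (e j)) ∧ e i₀ = k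

/-- The coefficient of the simple root `i₀` in the root `α`. -/
noncomputable def coeff (b : (LieAlgebra.IsKilling.rootSystem H).Base) (i₀ : b.support)
    (α : H.root) : ℂ :=
  b.toWeightBasis.repr ((LieAlgebra.IsKilling.rootSystem H).root α) i₀

/-- The real points `V ∩ 𝔤` of a subspace `V` of the complexification. -/
noncomputable def realPoints (V : Submodule ℂ (ℂ ⊗[ℝ] 𝔤)) : Submodule ℝ 𝔤 :=
  (V.restrictScalars ℝ).comap (TensorProduct.mk ℝ ℂ 𝔤 1)

/-- The isotropy algebra `𝔨` of the flag manifold: the real points of the sum of `H` and of the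
root spaces of the roots in which `i₀` has coefficient `0`. -/
noncomputable def isotropy (b : (LieAlgebra.IsKilling.rootSystem H).Base) (i₀ : b.support) :
    Submodule ℝ 𝔤 :=
  realPoints (H.toSubmodule ⊔
    ⨆ α : H.root, ⨆ _ : coeff b i₀ α = 0, (LieAlgebra.rootSpace H (α : H → ℂ)).toSubmodule)

/-- The centre `𝔨₀` of `𝔨`. -/
noncomputable def isotropyCentre (b : (LieAlgebra.IsKilling.rootSystem H).Base)
    (i₀ : b.support) : Submodule ℝ 𝔤 :=
  isotropy b i₀ ⊓ ⨅ Y ∈ isotropy b i₀, LinearMap.ker (LieAlgebra.ad ℝ 𝔤 Y)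

/-- The semisimple part `𝔨₁ = [𝔨, 𝔨]` of `𝔨`. -/
noncomputable def isotropyDerived (b : (LieAlgebra.IsKilling.rootSystem H).Base)
    (i₀ : b.support) : Submodule ℝ 𝔤 :=
  Submodule.span ℝ {Z | ∃ X ∈ isotropy b i₀, ∃ Y ∈ isotropy b i₀, ⁅X, Y⁆ = Z}

/-- The isotropy summand `𝔭ⱼ`: the real points of the sum of the root spaces of the roots in which
`i₀` has coefficient `j` or `-j`. -/
noncomputable def isotropySummand (b : (LieAlgebra.IsKilling.rootSystem H).Base)
    (i₀ : b.support) (j : ℕ) : Submodule ℝ 𝔤 :=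
  realPoints (⨆ α : H.root, ⨆ _ : coeff b i₀ α = j ∨ coeff b i₀ α = -j,
    (LieAlgebra.rootSpace H (α : H → ℂ)).toSubmodule)

/-- The decomposition `𝔤 = 𝔨₀ ⊕ 𝔨₁ ⊕ 𝔭₁ ⊕ 𝔭₂ ⊕ 𝔭₃`. -/
noncomputable def component (b : (LieAlgebra.IsKilling.rootSystem H).Base)
    (i₀ : b.support) : Fin 5 → Submodule ℝ 𝔤 :=
  ![isotropyCentre b i₀, isotropyDerived b i₀,
    isotropySummand b i₀ 1, isotropySummand b i₀ 2, isotropySummand b i₀ 3]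

/-- The bilinear form `m` is
`u₀ B|𝔨₀ + u₁ B|𝔨₁ + x₁ B|𝔭₁ + x₂ B|𝔭₂ + x₃ B|𝔭₃` with `(u₀, u₁, x₁, x₂, x₃) = c`, where
`B` is the negative of the Killing form: distinct summands are orthogonal, and `m` is the
corresponding multiple of `B` on each summand. -/
def IsDiagonalMetric (b : (LieAlgebra.IsKilling.rootSystem H).Base) (i₀ : b.support)
    (m : LinearMap.BilinForm ℝ 𝔤) (c : Fin 5 → ℝ) : Prop :=
  ∀ i j : Fin 5, ∀ X ∈ component b i₀ i, ∀ Y ∈ component b i₀ j,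
    m X Y = if i = j then c i * -(killingForm ℝ 𝔤 X Y) else 0

end Roots

end NatRed

/-!
Let `K` be the Killing form, which is negative definite because averaging over the compact group
gives an invariant inner product for which every `ad X` is skew (`killingForm_neg`). Write the
metric as `-K(M ·, ·)`, with `M` the multiple `u₀, u₁, x₁, x₂, x₃` of the identity on the five
summands.

**The algebraic criterion.** A complement `𝔪` as in the definition of natural reductivity is a
graph `{(S X, S X - X)}` with `S X - X ∈ 𝔩`, and invariance of the metric says that `ad V` commutes
with `M` for `V ∈ 𝔩`. The condition on the metric then becomes `⁅S Y, M Y⁆ = 0` for all `Y`, that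
is `⁅T y, y⁆ = 0` for `T = S M⁻¹`. A linear map with this property commutes with the adjoint
representation and is self-adjoint for `K` (`commutes_ad_of_lie_self_eq_zero`), so that on a simple
Lie algebra with definite Killing form it is a scalar `r`, and `S = r M`. Hence `ad (r M X - X)`
commutes with `M` for all `X`. Conversely, if this holds for some `r`, one may take for `L` the
commutant of `M` in `G`, which is closed and has the commutant of `M` in `𝔤` as its Lie algebra
(`exists_isNaturallyReductive`). As `M` is scalar on each summand, the criterion reads: for some
`r`, each summand either has `r c = 1`, with `c` the value of `M` on it, or commutes with `M`
(`exists_isNaturallyReductive_iff`).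

**The grading.** The fundamental coweight of `α_{i₀}` is `i` times an element `Z` of `𝔤`
(`exists_isGradingElement`). So the summands can be described by the real operator `(ad Z)²`, which
acts on them by `0, 0, -1, -4, -9` (`IsGradingElement.component_eq`), and the bracket of the spaces
for `-r²` and `-s²` lies in the sum of those for `-(r + s)²` and `-(r - s)²`. The space `𝔨` always
commutes with `M`. If `𝔭₁` commutes with `M` then `x₁ = x₂ = x₃`; otherwise `r = 1 / x₁`, and
`x₂ ≠ x₁` or `x₃ ≠ x₁` is possible only if `𝔭₂` or `𝔭₃` commutes with `M`. For `𝔭₃` this means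
`u₀ = u₁ = x₃` and `x₁ = x₂`, for `𝔭₂` it means `u₀ = u₁ = x₂` and `x₁ = x₃`, except that `u₁` is
unconstrained if `[𝔨, 𝔨]` acts trivially on `𝔭₂` (`exists_scalar_iff`).

**The roots.** This needs a few nonzero brackets: `⁅𝔭₁, 𝔭₃⁆ ≠ 0`, `⁅𝔭₁, 𝔭₂⁆` has a component in
`𝔭₁`, and `[𝔨, 𝔨]` acts nontrivially on `𝔭₃` and, for `E₈`, on `𝔭₂`. They follow, by `𝔰𝔩₂`-theory,
from the existence of roots of degree `2` and `3` having suitable pairings with simple roots. Such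
roots are found by applying simple reflections to simple roots (`isDegreeThree_E₈`,
`isDegreeThree_G₂`), and the quadratic form of the root lattice bounds the degree of all roots by
`3`. For `G₂` it also shows that there is only one root of degree `2`, so that `[𝔨, 𝔨]` acts
trivially on `𝔭₂`.
-/

namespace NatRed

/-! ### Linear maps `T` with `⁅T y, y⁆ = 0` -/

section Quasicentroid

/-- The inner product structure given by a positive definite symmetric bilinear form. -/
abbrev coreOfPosDef {V : Type*} [AddCommGroup V] [Module ℝ V] (Q : LinearMap.BilinForm ℝ V)
    (hsymm : ∀ x y, Q x y = Q y x) (hpos : ∀ x, x ≠ 0 → 0 < Q x x) :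
    InnerProductSpace.Core ℝ V where
  inner := fun x y => Q x y
  conj_inner_symm := fun x y => by simp [hsymm x y]
  re_inner_nonneg := fun x => by
    rcases eq_or_ne x 0 with rfl | h
    · simp
    · simpa using (hpos x h).le
  add_left := fun x y z => by simp
  smul_left := fun x y r => by simp
  definite := fun x hx => by
    by_contra h
    exact (hpos x h).ne' hx

/-- A real endomorphism that is self-adjoint for a positive definite form has an eigenvector. -/
theorem exists_eigenvector_of_posDef {V : Type*} [AddCommGroup V] [Module ℝ V]
    [Module.Finite ℝ V] [Nontrivial V] (Q : LinearMap.BilinForm ℝ V)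
    (hsymm : ∀ x y, Q x y = Q y x) (hpos : ∀ x, x ≠ 0 → 0 < Q x x)
    (T : V →ₗ[ℝ] V) (hT : ∀ x y, Q (T x) y = Q x (T y)) :
    ∃ (c : ℝ) (v : V), v ≠ 0 ∧ T v = c • v := by
  let core := coreOfPosDef Q hsymm hpos
  let _ : NormedAddCommGroup V := core.toNormedAddCommGroup
  let _ : InnerProductSpace ℝ V := InnerProductSpace.ofCore core.toCore
  have hs : T.IsSymmetric := fun x y => hT x y
  have hn : Module.finrank ℝ V = (Module.finrank ℝ V - 1) + 1 := by
    have := Module.finrank_pos (R := ℝ) (M := V)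
    omega
  exact ⟨_, hs.eigenvectorBasis rfl ⟨0, Module.finrank_pos⟩,
    (hs.eigenvectorBasis rfl).toBasis.ne_zero ⟨0, Module.finrank_pos⟩ |> fun h => by simpa using h,
    hs.apply_eigenvectorBasis rfl _⟩

/-- If `f` is skew for a positive definite form, then `tr (f ∘ f) ≤ 0`, with equality only
for `f = 0`. -/
theorem trace_sq_neg_of_skew {V : Type*} [AddCommGroup V] [Module ℝ V]
    [Module.Finite ℝ V] (Q : LinearMap.BilinForm ℝ V)
    (hsymm : ∀ x y, Q x y = Q y x) (hpos : ∀ x, x ≠ 0 → 0 < Q x x)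
    (f : V →ₗ[ℝ] V) (hf : ∀ x y, Q (f x) y = -Q x (f y)) (h0 : f ≠ 0) :
    LinearMap.trace ℝ V (f ∘ₗ f) < 0 := by
  let core := coreOfPosDef Q hsymm hpos
  let _ : NormedAddCommGroup V := core.toNormedAddCommGroup
  let _ : InnerProductSpace ℝ V := InnerProductSpace.ofCore core.toCore
  let e := stdOrthonormalBasis ℝ V
  rw [LinearMap.trace_eq_sum_inner _ e]
  have hin : ∀ x y : V, inner ℝ x y = Q x y := fun _ _ => rfl
  have hterm : ∀ i, inner ℝ (e i) ((f ∘ₗ f) (e i)) = -Q (f (e i)) (f (e i)) := fun i => by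
    rw [hin, LinearMap.comp_apply, hf, neg_neg]
  simp only [hterm, Finset.sum_neg_distrib, neg_lt_zero]
  have hnn : ∀ x, 0 ≤ Q x x := fun x => by
    rcases eq_or_ne x 0 with rfl | h
    · simp
    · exact (hpos x h).le
  obtain ⟨i, hi⟩ : ∃ i, f (e i) ≠ 0 := by
    by_contra! h
    exact h0 (e.toBasis.ext fun i => by simpa using h i)
  exact Finset.sum_pos' (fun i _ => hnn _) ⟨i, Finset.mem_univ _, hpos _ hi⟩

variable {𝔤 : Type*} [LieRing 𝔤] [LieAlgebra ℝ 𝔤]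

theorem eq_of_killingForm_eq [LieAlgebra.IsKilling ℝ 𝔤] {x y : 𝔤}
    (h : ∀ w, killingForm ℝ 𝔤 x w = killingForm ℝ 𝔤 y w) : x = y := by
  have hnd := LieAlgebra.IsKilling.killingForm_nondegenerate ℝ 𝔤
  rw [← sub_eq_zero]
  refine hnd.1 _ fun w => ?_
  simp [h w]

theorem killingForm_lie_left (x y z : 𝔤) :
    killingForm ℝ 𝔤 ⁅x, y⁆ z = killingForm ℝ 𝔤 x ⁅y, z⁆ :=
  LieModule.traceForm_apply_lie_apply ℝ 𝔤 𝔤 x y z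

theorem killingForm_symm (x y : 𝔤) : killingForm ℝ 𝔤 x y = killingForm ℝ 𝔤 y x :=
  LieModule.traceForm_comm ℝ 𝔤 𝔤 x y

theorem killingForm_lie_skew (x y z : 𝔤) :
    killingForm ℝ 𝔤 ⁅x, y⁆ z = -killingForm ℝ 𝔤 y ⁅x, z⁆ := by
  rw [← lie_skew, map_neg, LinearMap.neg_apply, killingForm_lie_left]

variable [Module.Finite ℝ 𝔤]

theorem eq_zero_of_forall_lie_eq_zero [LieAlgebra.IsKilling ℝ 𝔤] {v : 𝔤}
    (h : ∀ x : 𝔤, ⁅x, v⁆ = 0) : v = 0 := by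
  have : v ∈ LieAlgebra.center ℝ 𝔤 := h
  simpa using this

/-- Every bilinear form is the Killing form composed with an operator. -/
theorem exists_operator_of_bilin [LieAlgebra.IsKilling ℝ 𝔤] (Q : LinearMap.BilinForm ℝ 𝔤) :
    ∃ N : 𝔤 →ₗ[ℝ] 𝔤, ∀ X Y, Q X Y = killingForm ℝ 𝔤 (N X) Y := by
  have hnd := LieAlgebra.IsKilling.killingForm_nondegenerate ℝ 𝔤
  exact ⟨((killingForm ℝ 𝔤).toDual hnd).symm.toLinearMap ∘ₗ Q, fun X Y =>
    (LinearMap.BilinForm.apply_toDual_symm_apply (hB := hnd) (Q X) Y).symm⟩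

/-- A linear map with `⁅T y, y⁆ = 0` for all `y` commutes with the adjoint representation and
is self-adjoint for the Killing form. The trilinear expression `⁅y, U ⁅z, x⁆⁆ - U ⁅y, ⁅z, x⁆⁆`,
where `U` is the Killing adjoint of `T`, is symmetric in `y, z` and skew in `z, x`, so it
vanishes. -/
theorem commutes_ad_of_lie_self_eq_zero [LieAlgebra.IsKilling ℝ 𝔤] (T : 𝔤 →ₗ[ℝ] 𝔤)
    (h : ∀ y : 𝔤, ⁅T y, y⁆ = 0) :
    (∀ x y : 𝔤, T ⁅x, y⁆ = ⁅x, T y⁆) ∧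
      ∀ x y, killingForm ℝ 𝔤 (T x) y = killingForm ℝ 𝔤 x (T y) := by
  have hnd := LieAlgebra.IsKilling.killingForm_nondegenerate ℝ 𝔤
  have h2 : ∀ x y : 𝔤, ⁅T x, y⁆ = ⁅x, T y⁆ := fun x y => by
    have := h (x + y)
    simp only [map_add, add_lie, lie_add, h, zero_add, add_zero] at this
    rw [← lie_skew x (T y), ← sub_eq_zero, sub_neg_eq_add, add_comm, this]
  set U := (killingForm ℝ 𝔤).leftAdjointOfNondegenerate hnd T
  have hU : ∀ x y, killingForm ℝ 𝔤 (U x) y = killingForm ℝ 𝔤 x (T y) := fun x y =>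
    (LinearMap.BilinForm.isAdjointPairLeftAdjointOfNondegenerate _ hnd T) x y
  have hUlie : ∀ x y : 𝔤, U ⁅x, y⁆ = ⁅x, T y⁆ := fun x y => eq_of_killingForm_eq fun w => by
    rw [hU, killingForm_lie_left, ← h2, ← killingForm_lie_left]
  let F : 𝔤 → 𝔤 → 𝔤 → 𝔤 := fun y z x => ⁅y, U ⁅z, x⁆⁆ - U ⁅y, ⁅z, x⁆⁆
  have hF1 : ∀ y z x, F y z x = F z y x := fun y z x => by
    have e1 : U ⁅⁅y, z⁆, x⁆ = ⁅⁅y, z⁆, T x⁆ := hUlie _ _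
    have e2 : ⁅⁅y, z⁆, x⁆ = ⁅y, ⁅z, x⁆⁆ - ⁅z, ⁅y, x⁆⁆ := lie_lie y z x
    have e3 : ⁅⁅y, z⁆, T x⁆ = ⁅y, ⁅z, T x⁆⁆ - ⁅z, ⁅y, T x⁆⁆ := lie_lie y z (T x)
    rw [e2, map_sub, e3] at e1
    simp only [F, hUlie z x, hUlie y x]
    rw [sub_eq_sub_iff_sub_eq_sub, e1]
  have hF2 : ∀ y z x, F y z x = -F y x z := fun y z x => by
    simp only [F]
    rw [← lie_skew z x]
    simp only [map_neg, lie_neg]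
    abel
  have hF0 : ∀ y z x, F y z x = 0 := fun a b c => by
    have : F a b c = -F a b c := by
      conv_lhs => rw [hF1, hF2, hF1, hF2, hF1, hF2]
      simp
    have : IsAddTorsionFree 𝔤 := .of_isTorsionFree ℝ 𝔤
    exact self_eq_neg.mp ‹F a b c = _›
  have hUT : ∀ z x : 𝔤, U ⁅z, x⁆ = T ⁅z, x⁆ := fun z x => by
    rw [← sub_eq_zero]
    refine eq_zero_of_forall_lie_eq_zero fun y => ?_
    have := hF0 y z x
    simp only [F] at this
    rw [hUlie y ⁅z, x⁆, ← lie_sub] at this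
    exact this
  have hUT' : U = T := by
    ext v
    rw [← sub_eq_zero]
    refine eq_zero_of_forall_lie_eq_zero fun x => eq_of_killingForm_eq fun z => ?_
    have : killingForm ℝ 𝔤 ⁅z, x⁆ (U v - T v) = 0 := by
      rw [map_sub, ← hU, hUT, killingForm_symm _ (U v), hU, killingForm_symm v, sub_self]
    rw [killingForm_symm, ← killingForm_lie_left, this]
    simp
  exact ⟨fun x y => by rw [← hUT, hUlie], fun x y => by rw [← hU, hUT']⟩

/-- In a simple Lie algebra with definite Killing form, a linear map with `⁅T y, y⁆ = 0` for all
`y` is a homothety. -/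
theorem exists_eq_smul_of_lie_self_eq_zero [LieAlgebra.IsSimple ℝ 𝔤]
    (hneg : ∀ x : 𝔤, x ≠ 0 → killingForm ℝ 𝔤 x x < 0) (T : 𝔤 →ₗ[ℝ] 𝔤)
    (h : ∀ y : 𝔤, ⁅T y, y⁆ = 0) : ∃ c : ℝ, ∀ x, T x = c • x := by
  obtain ⟨hcomm, hsa⟩ := commutes_ad_of_lie_self_eq_zero T h
  have : Nontrivial 𝔤 := by
    by_contra hn
    rw [not_nontrivial_iff_subsingleton] at hn
    exact LieAlgebra.IsSimple.non_abelian (R := ℝ) (L := 𝔤)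
      ⟨fun x y => Subsingleton.elim _ _⟩
  obtain ⟨c, v, hv, hTv⟩ := exists_eigenvector_of_posDef (-killingForm ℝ 𝔤)
    (fun x y => by simp [killingForm_symm x y]) (fun x hx => by simpa using hneg x hx) T
    (fun x y => by simp [hsa x y])
  let I : LieIdeal ℝ 𝔤 :=
    { LinearMap.ker (T - c • LinearMap.id) with
      lie_mem := fun {x y} hy => by
        have hy' : T y = c • y := by simpa [sub_eq_zero] using hy
        change ⁅x, y⁆ ∈ LinearMap.ker (T - c • LinearMap.id)
        simp [hcomm, hy'] }
  have hmem : ∀ x, x ∈ I ↔ T x = c • x := fun x => by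
    change x ∈ LinearMap.ker (T - c • LinearMap.id) ↔ _
    simp [sub_eq_zero]
  rcases LieAlgebra.IsSimple.eq_bot_or_eq_top I with hI | hI
  · exact absurd ((LieSubmodule.mem_bot v).1 (hI ▸ (hmem v).2 hTv)) hv
  · exact ⟨c, fun x => (hmem x).1 (hI ▸ LieSubmodule.mem_top x)⟩

end Quasicentroid
/-! ### The adjoint representation and the commutant of a linear map -/

section Analysis

open NormedSpace

variable {n : ℕ} {G : Subgroup (GL (Fin n) ℝ)}
  {𝔤 : LieSubalgebra ℝ (Matrix (Fin n) (Fin n) ℝ)}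

theorem coe_Ad (hG : IsLieAlgebraOf G 𝔤) (g : G) (X : 𝔤) :
    (Ad hG g X : Matrix (Fin n) (Fin n) ℝ) =
      ((g : GL (Fin n) ℝ) : Matrix (Fin n) (Fin n) ℝ) * (X : Matrix (Fin n) (Fin n) ℝ) *
      (((g : GL (Fin n) ℝ)⁻¹ : GL (Fin n) ℝ) : Matrix (Fin n) (Fin n) ℝ) := rfl

/-- `Ad(g)` as an automorphism of the Lie algebra. -/
def adEquiv (hG : IsLieAlgebraOf G 𝔤) (g : G) : 𝔤 ≃ₗ⁅ℝ⁆ 𝔤 where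
  toFun := Ad hG g
  invFun := Ad hG g⁻¹
  left_inv X := by
    apply Subtype.ext
    simp [coe_Ad, mul_assoc]
  right_inv X := by
    apply Subtype.ext
    simp [coe_Ad, mul_assoc]
  map_add' X Y := by
    apply Subtype.ext
    simp [coe_Ad, mul_add, add_mul]
  map_smul' c X := by
    apply Subtype.ext
    simp [coe_Ad]
  map_lie' {X Y} := by
    apply Subtype.ext
    simp [coe_Ad, LieRing.of_associative_ring_bracket, mul_sub, sub_mul, mul_assoc]

@[simp] theorem adEquiv_apply (hG : IsLieAlgebraOf G 𝔤) (g : G) (X : 𝔤) :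
    adEquiv hG g X = Ad hG g X := rfl

theorem killingForm_Ad (hG : IsLieAlgebraOf G 𝔤) (g : G) (X Y : 𝔤) :
    killingForm ℝ 𝔤 (Ad hG g X) (Ad hG g Y) = killingForm ℝ 𝔤 X Y :=
  LieAlgebra.killingForm_of_equiv_apply (adEquiv hG g) X Y

theorem exp_neg_eq_inv_of_eq_exp {X : Matrix (Fin n) (Fin n) ℝ} {g : GL (Fin n) ℝ}
    (hg : (g : Matrix (Fin n) (Fin n) ℝ) = exp X) :
    ((g⁻¹ : GL (Fin n) ℝ) : Matrix (Fin n) (Fin n) ℝ) = exp (-X) := by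
  rw [Matrix.exp_neg, ← hg, Matrix.coe_units_inv]

open scoped Matrix.Norms.Operator in
theorem hasDerivAt_exp_conj (X Y : Matrix (Fin n) (Fin n) ℝ) (t : ℝ) :
    HasDerivAt (fun s : ℝ => exp (s • X) * Y * exp (-(s • X)))
      (exp (t • X) * (X * Y - Y * X) * exp (-(t • X))) t := by
  have h1 : HasDerivAt (fun s : ℝ => exp (s • X)) (exp (t • X) * X) t :=
    hasDerivAt_exp_smul_const X t
  have h2 : HasDerivAt (fun s : ℝ => exp (s • (-X))) (-X * exp (t • (-X))) t :=
    hasDerivAt_exp_smul_const' (-X) t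
  simp only [smul_neg] at h2
  convert! (h1.mul_const Y).mul h2 using 1
  simp only [mul_sub, sub_mul, mul_assoc, neg_mul, mul_neg]
  abel

open scoped Matrix.Norms.Operator in
/-- A linear map commutes with `Ad(exp(tX))` for all `t` if and only if it commutes with
`ad X`. -/
theorem forall_comm_exp_iff (hG : IsLieAlgebraOf G 𝔤) (A : 𝔤 →ₗ[ℝ] 𝔤) (X : 𝔤) :
    (∀ (t : ℝ) (g : G), ((g : GL (Fin n) ℝ) : Matrix (Fin n) (Fin n) ℝ) =
        exp (t • (X : Matrix (Fin n) (Fin n) ℝ)) →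
      ∀ Y, Ad hG g (A Y) = A (Ad hG g Y)) ↔ ∀ Y : 𝔤, ⁅X, A Y⁆ = A ⁅X, Y⁆ := by
  -- a linear extension of `A` to all matrices, so that derivatives can be taken there
  obtain ⟨A', hA'⟩ := LinearMap.exists_extend (p := 𝔤.toSubmodule)
    (𝔤.toSubmodule.subtype ∘ₗ (A : 𝔤.toSubmodule →ₗ[ℝ] 𝔤.toSubmodule))
  have hA : ∀ Y : 𝔤, A' (Y : Matrix (Fin n) (Fin n) ℝ) = (A Y : Matrix (Fin n) (Fin n) ℝ) :=
    fun Y => LinearMap.congr_fun hA' Y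
  let A'c := LinearMap.toContinuousLinearMap A'
  have hder : ∀ (Y : Matrix (Fin n) (Fin n) ℝ) (t : ℝ),
      HasDerivAt (fun s : ℝ => A' (exp (s • (X : Matrix (Fin n) (Fin n) ℝ)) * Y *
        exp (-(s • (X : Matrix (Fin n) (Fin n) ℝ)))))
      (A' (exp (t • (X : Matrix (Fin n) (Fin n) ℝ)) * ((X : Matrix (Fin n) (Fin n) ℝ) * Y - Y * X) *
        exp (-(t • (X : Matrix (Fin n) (Fin n) ℝ))))) t := fun Y t =>
    A'c.hasFDerivAt.comp_hasDerivAt t (hasDerivAt_exp_conj _ Y t)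
  have hAd : ∀ (t : ℝ) (g : G), ((g : GL (Fin n) ℝ) : Matrix (Fin n) (Fin n) ℝ) =
      exp (t • (X : Matrix (Fin n) (Fin n) ℝ)) → ∀ Y : 𝔤,
      (Ad hG g Y : Matrix (Fin n) (Fin n) ℝ) = exp (t • (X : Matrix (Fin n) (Fin n) ℝ)) * Y *
        exp (-(t • (X : Matrix (Fin n) (Fin n) ℝ))) := fun t g hg Y => by
    rw [coe_Ad, exp_neg_eq_inv_of_eq_exp hg, hg]
  constructor
  · intro h Y
    have hfun : (fun s : ℝ => exp (s • (X : Matrix (Fin n) (Fin n) ℝ)) * (A Y) *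
        exp (-(s • (X : Matrix (Fin n) (Fin n) ℝ)))) = fun s : ℝ => A'
        (exp (s • (X : Matrix (Fin n) (Fin n) ℝ)) * Y *
          exp (-(s • (X : Matrix (Fin n) (Fin n) ℝ)))) := by
      funext s
      obtain ⟨g, hg, he⟩ := (hG X).1 X.2 s
      rw [← hAd s ⟨g, hg⟩ he, ← hAd s ⟨g, hg⟩ he, hA, h s ⟨g, hg⟩ he]
    have h1 := hasDerivAt_exp_conj (X : Matrix (Fin n) (Fin n) ℝ) (A Y) 0
    rw [hfun] at h1
    have h2 := h1.unique (hder Y 0)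
    simp only [zero_smul, exp_zero, one_mul, neg_zero, mul_one] at h2
    apply Subtype.ext
    rw [← hA]
    exact h2
  · intro h t g hg Y
    -- `exp(-sX) A(exp(sX) Y exp(-sX)) exp(sX)` does not depend on `s`
    have hconst : ∀ s : ℝ, HasDerivAt (fun s : ℝ =>
        exp (s • -(X : Matrix (Fin n) (Fin n) ℝ)) * A' (exp (s • (X : Matrix (Fin n) (Fin n) ℝ)) *
          Y * exp (-(s • (X : Matrix (Fin n) (Fin n) ℝ)))) *
          exp (s • (X : Matrix (Fin n) (Fin n) ℝ))) 0 s := fun s => by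
      have h1 : HasDerivAt (fun s : ℝ => exp (s • -(X : Matrix (Fin n) (Fin n) ℝ)))
          (exp (s • -(X : Matrix (Fin n) (Fin n) ℝ)) * -X) s := hasDerivAt_exp_smul_const _ s
      have h2 : HasDerivAt (fun s : ℝ => exp (s • (X : Matrix (Fin n) (Fin n) ℝ)))
          (X * exp (s • (X : Matrix (Fin n) (Fin n) ℝ))) s := hasDerivAt_exp_smul_const' _ s
      convert! (h1.mul (hder Y s)).mul h2 using 1
      simp only [Pi.mul_apply]
      obtain ⟨g, hg, he⟩ := (hG X).1 X.2 s
      have e1 := hAd s ⟨g, hg⟩ he Y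
      have e2 := hAd s ⟨g, hg⟩ he ⁅X, Y⁆
      rw [LieSubalgebra.coe_bracket, LieRing.of_associative_ring_bracket] at e2
      rw [← e1, ← e2, hA, hA]
      have e3 : Ad hG ⟨g, hg⟩ ⁅X, Y⁆ = ⁅X, Ad hG ⟨g, hg⟩ Y⁆ := by
        have hX : Ad hG ⟨g, hg⟩ X = X := by
          apply Subtype.ext
          rw [hAd s ⟨g, hg⟩ he X]
          have hc : Commute (exp (s • (X : Matrix (Fin n) (Fin n) ℝ)))
              (X : Matrix (Fin n) (Fin n) ℝ) :=
            ((Commute.refl (X : Matrix (Fin n) (Fin n) ℝ)).smul_left s).exp_left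
          rw [hc.eq, mul_assoc, Matrix.exp_neg, Matrix.mul_nonsing_inv, mul_one]
          exact (Matrix.isUnit_iff_isUnit_det _).1 (Matrix.isUnit_exp _)
        have := (adEquiv hG ⟨g, hg⟩).map_lie X Y
        simp only [adEquiv_apply, hX] at this
        exact this
      rw [e3, ← h, LieSubalgebra.coe_bracket, LieRing.of_associative_ring_bracket]
      noncomm_ring
    have hdiff : Differentiable ℝ (fun s : ℝ =>
        exp (s • -(X : Matrix (Fin n) (Fin n) ℝ)) * A' (exp (s • (X : Matrix (Fin n) (Fin n) ℝ)) *
          Y * exp (-(s • (X : Matrix (Fin n) (Fin n) ℝ)))) *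
          exp (s • (X : Matrix (Fin n) (Fin n) ℝ))) := fun s => (hconst s).differentiableAt
    have h0 := is_const_of_deriv_eq_zero hdiff (fun s => (hconst s).deriv) t 0
    simp only [zero_smul, exp_zero, one_mul, neg_zero, mul_one, smul_neg] at h0
    apply Subtype.ext
    rw [hAd t g hg (A Y), ← hA (Ad hG g Y), hAd t g hg Y, ← hA Y, ← h0]
    have hu : IsUnit (exp (t • (X : Matrix (Fin n) (Fin n) ℝ))).det :=
      (Matrix.isUnit_iff_isUnit_det _).1 (Matrix.isUnit_exp _)
    have i1 : exp (t • (X : Matrix (Fin n) (Fin n) ℝ)) *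
        exp (-(t • (X : Matrix (Fin n) (Fin n) ℝ))) = 1 := by
      rw [Matrix.exp_neg, Matrix.mul_nonsing_inv _ hu]
    generalize A' _ = W
    calc _ = (exp (t • (X : Matrix (Fin n) (Fin n) ℝ)) *
        exp (-(t • (X : Matrix (Fin n) (Fin n) ℝ)))) * W *
        (exp (t • (X : Matrix (Fin n) (Fin n) ℝ)) *
        exp (-(t • (X : Matrix (Fin n) (Fin n) ℝ)))) := by simp only [mul_assoc]
      _ = W := by rw [i1, one_mul, mul_one]

/-- The commutant of `A` in `G` has the commutant of `A` in `𝔤` as its Lie algebra. -/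
theorem isLieAlgebraOf_commutant (hG : IsLieAlgebraOf G 𝔤) (A : 𝔤 →ₗ[ℝ] 𝔤) (L : Subgroup G)
    (hL : ∀ g, g ∈ L ↔ ∀ Y, Ad hG g (A Y) = A (Ad hG g Y)) (𝔩 : LieSubalgebra ℝ 𝔤)
    (h𝔩 : ∀ X, X ∈ 𝔩 ↔ ∀ Y : 𝔤, ⁅X, A Y⁆ = A ⁅X, Y⁆) :
    IsLieAlgebraOf (L.map G.subtype) (𝔩.map 𝔤.incl) := by
  intro X
  constructor
  · intro hX t
    obtain ⟨V, hV, rfl⟩ := (LieSubalgebra.mem_map _ _ _).1 hX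
    obtain ⟨g, hg, he⟩ := (hG V).1 V.2 t
    exact ⟨g, ⟨⟨g, hg⟩, (hL _).2 ((forall_comm_exp_iff hG A V).2 ((h𝔩 V).1 hV) t _ he), rfl⟩, he⟩
  · intro h
    have hX : X ∈ 𝔤 := (hG X).2 fun t => by
      obtain ⟨_, ⟨g, -, rfl⟩, he⟩ := h t
      exact ⟨g, g.2, he⟩
    refine (LieSubalgebra.mem_map _ _ _).2 ⟨⟨X, hX⟩, (h𝔩 _).2 ?_, rfl⟩
    refine (forall_comm_exp_iff hG A ⟨X, hX⟩).1 fun t g hg => ?_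
    obtain ⟨_, ⟨g', hg', rfl⟩, he⟩ := h t
    have : g' = g := Subtype.ext (Units.ext (he.trans hg.symm))
    exact (hL g).1 (this ▸ hg')

theorem isClosed_commutant (hG : IsLieAlgebraOf G 𝔤) (A : 𝔤 →ₗ[ℝ] 𝔤) :
    IsClosed {g : G | ∀ Y, Ad hG g (A Y) = A (Ad hG g Y)} := by
  obtain ⟨A', hA'⟩ := LinearMap.exists_extend (p := 𝔤.toSubmodule)
    (𝔤.toSubmodule.subtype ∘ₗ (A : 𝔤.toSubmodule →ₗ[ℝ] 𝔤.toSubmodule))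
  have hA : ∀ Y : 𝔤, A' (Y : Matrix (Fin n) (Fin n) ℝ) = (A Y : Matrix (Fin n) (Fin n) ℝ) :=
    fun Y => LinearMap.congr_fun hA' Y
  have hc : Continuous A' := LinearMap.continuous_of_finiteDimensional A'
  have hcoe : Continuous fun g : G => ((g : GL (Fin n) ℝ) : Matrix (Fin n) (Fin n) ℝ) :=
    Units.continuous_val.comp continuous_subtype_val
  have hinv : Continuous fun g : G =>
      (((g : GL (Fin n) ℝ)⁻¹ : GL (Fin n) ℝ) : Matrix (Fin n) (Fin n) ℝ) :=
    Units.continuous_val.comp (continuous_inv.comp continuous_subtype_val)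
  simp only [Set.ofPred_forall]
  refine isClosed_iInter fun Y => ?_
  have : {g : G | Ad hG g (A Y) = A (Ad hG g Y)} =
      {g : G | ((g : GL (Fin n) ℝ) : Matrix (Fin n) (Fin n) ℝ) * (A Y) *
        (((g : GL (Fin n) ℝ)⁻¹ : GL (Fin n) ℝ) : Matrix (Fin n) (Fin n) ℝ) =
        A' (((g : GL (Fin n) ℝ) : Matrix (Fin n) (Fin n) ℝ) * Y *
        (((g : GL (Fin n) ℝ)⁻¹ : GL (Fin n) ℝ) : Matrix (Fin n) (Fin n) ℝ))} := by
    ext g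
    rw [Set.mem_ofPred_eq, Set.mem_ofPred_eq, ← coe_Ad hG, ← coe_Ad hG, hA, Subtype.ext_iff]
  rw [this]
  exact isClosed_eq ((hcoe.mul continuous_const).mul hinv)
    (hc.comp ((hcoe.mul continuous_const).mul hinv))

end Analysis

/-! ### The Killing form of a compact group -/

section Averaging

open MeasureTheory NormedSpace

variable {n : ℕ} {G : Subgroup (GL (Fin n) ℝ)}
  {𝔤 : LieSubalgebra ℝ (Matrix (Fin n) (Fin n) ℝ)}

/-- Averaging the trace form `tr(Xᵀ Y)` over a compact group gives an invariant inner product. -/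
theorem exists_invariant_inner (hcompact : IsCompact (G : Set (GL (Fin n) ℝ)))
    (hG : IsLieAlgebraOf G 𝔤) :
    ∃ Q : LinearMap.BilinForm ℝ 𝔤, (∀ X Y, Q X Y = Q Y X) ∧ (∀ X, X ≠ 0 → 0 < Q X X) ∧
      ∀ g X Y, Q (Ad hG g X) (Ad hG g Y) = Q X Y := by
  have : CompactSpace G := isCompact_iff_compactSpace.1 hcompact
  let _ : MeasurableSpace G := borel G
  have : BorelSpace G := ⟨rfl⟩
  let μ : Measure G := Measure.haar
  have hcoe : Continuous fun g : G => ((g : GL (Fin n) ℝ) : Matrix (Fin n) (Fin n) ℝ) :=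
    Units.continuous_val.comp continuous_subtype_val
  have hinv : Continuous fun g : G =>
      (((g : GL (Fin n) ℝ)⁻¹ : GL (Fin n) ℝ) : Matrix (Fin n) (Fin n) ℝ) :=
    Units.continuous_val.comp (continuous_inv.comp continuous_subtype_val)
  have hAd : ∀ X : 𝔤, Continuous fun g : G => (Ad hG g⁻¹ X : Matrix (Fin n) (Fin n) ℝ) := fun X =>
    ((hcoe.mul continuous_const).mul hinv).comp continuous_inv
  let F : 𝔤 → 𝔤 → G → ℝ := fun X Y g =>
    ((Ad hG g⁻¹ X : Matrix (Fin n) (Fin n) ℝ).transpose * (Ad hG g⁻¹ Y)).trace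
  have hF : ∀ X Y, Continuous (F X Y) := fun X Y =>
    ((hAd X).matrix_transpose.matrix_mul (hAd Y)).matrix_trace
  have hint : ∀ X Y, Integrable (F X Y) μ := fun X Y =>
    (hF X Y).integrable_of_hasCompactSupport (HasCompactSupport.of_compactSpace _)
  have hadd : ∀ g X Y, Ad hG g (X + Y) = Ad hG g X + Ad hG g Y := fun g => (adEquiv hG g).map_add
  have hsmul : ∀ g (c : ℝ) X, Ad hG g (c • X) = c • Ad hG g X := fun g =>
    (adEquiv hG g).map_smul
  have hpos : ∀ M : Matrix (Fin n) (Fin n) ℝ, 0 ≤ (M.transpose * M).trace := fun M => by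
    simpa using (Matrix.posSemidef_conjTranspose_mul_self M).trace_nonneg
  refine ⟨LinearMap.mk₂ ℝ (fun X Y => ∫ g, F X Y g ∂μ) ?_ ?_ ?_ ?_, ?_, ?_, ?_⟩
  · intro X X' Y
    rw [← integral_add (hint _ _) (hint _ _)]
    refine integral_congr_ae (.of_forall fun g => ?_)
    simp [F, hadd, add_mul]
  · intro c X Y
    rw [smul_eq_mul, ← integral_const_mul]
    refine integral_congr_ae (.of_forall fun g => ?_)
    simp [F, hsmul]
  · intro X Y Y'
    rw [← integral_add (hint _ _) (hint _ _)]
    refine integral_congr_ae (.of_forall fun g => ?_)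
    simp [F, hadd, mul_add]
  · intro c X Y
    rw [smul_eq_mul, ← integral_const_mul]
    refine integral_congr_ae (.of_forall fun g => ?_)
    simp [F, hsmul]
  · intro X Y
    refine integral_congr_ae (.of_forall fun g => ?_)
    change Matrix.trace _ = Matrix.trace _
    rw [← Matrix.trace_transpose, Matrix.transpose_mul, Matrix.transpose_transpose]
  · intro X hX
    refine (hF X X).integral_pos_of_hasCompactSupport_nonneg_nonzero
      (HasCompactSupport.of_compactSpace _) (fun g => hpos _) (x := 1) fun h => hX ?_
    have h1 : Ad hG 1 X = X := Subtype.ext (by simp [coe_Ad])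
    have h2 : ((X : Matrix (Fin n) (Fin n) ℝ).conjTranspose * X).trace = 0 := by
      simpa [F, h1] using h
    exact Subtype.ext (Matrix.trace_conjTranspose_mul_self_eq_zero_iff.1 h2)
  · intro g X Y
    have hcomp : ∀ h X, Ad hG h (Ad hG g X) = Ad hG (h * g) X := fun h X =>
      Subtype.ext (by simp [coe_Ad, mul_assoc])
    change ∫ h, F (Ad hG g X) (Ad hG g Y) h ∂μ = ∫ h, F X Y h ∂μ
    have : ∀ h, F (Ad hG g X) (Ad hG g Y) h = F X Y (g⁻¹ * h) := fun h => by
      simp only [F, hcomp, mul_inv_rev, inv_inv]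
    simp only [this]
    exact integral_mul_left_eq_self (F X Y) g⁻¹

/-- As the Killing form is invariant, an operator expressing an `Ad(g)`-invariant form through it
commutes with `Ad(g)`. -/
theorem comm_Ad_of_invariant (hG : IsLieAlgebraOf G 𝔤) [LieAlgebra.IsKilling ℝ 𝔤] (g : G)
    (Q : LinearMap.BilinForm ℝ 𝔤) (N : 𝔤 →ₗ[ℝ] 𝔤)
    (hN : ∀ X Y, Q X Y = killingForm ℝ 𝔤 (N X) Y)
    (hinv : ∀ X Y, Q (Ad hG g X) (Ad hG g Y) = Q X Y) (V : 𝔤) :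
    Ad hG g (N V) = N (Ad hG g V) :=
  eq_of_killingForm_eq fun W => by
    obtain ⟨W, rfl⟩ : ∃ W', Ad hG g W' = W := (adEquiv hG g).surjective W
    rw [killingForm_Ad, ← hN, ← hN, hinv]

/-- The Killing form of a compact linear group with nondegenerate Killing form is negative
definite: `ad X` is skew for an invariant inner product. -/
theorem killingForm_neg (hcompact : IsCompact (G : Set (GL (Fin n) ℝ)))
    (hG : IsLieAlgebraOf G 𝔤) [LieAlgebra.IsKilling ℝ 𝔤] (X : 𝔤) (hX : X ≠ 0) :
    killingForm ℝ 𝔤 X X < 0 := by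
  obtain ⟨Q, hsymm, hpos, hinv⟩ := exists_invariant_inner hcompact hG
  rw [killingForm_apply_apply]
  refine trace_sq_neg_of_skew Q hsymm hpos _ (fun Y W => ?_) fun h => hX ?_
  · -- the operator relating `Q` to the Killing form commutes with `Ad`, hence with `ad X`
    obtain ⟨N, hN⟩ := exists_operator_of_bilin Q
    have hcomm := (forall_comm_exp_iff hG N X).1 fun t g _ V => comm_Ad_of_invariant hG g Q N hN
      (hinv g) V
    rw [LieAlgebra.ad_apply, LieAlgebra.ad_apply, hN, hN, ← hcomm, killingForm_lie_skew]
  · exact eq_zero_of_forall_lie_eq_zero fun Y => by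
      rw [← lie_skew, ← LieAlgebra.ad_apply ℝ, h]
      simp

end Averaging
/-! ### Natural reductivity in terms of the operator of the metric -/

section Criterion

variable {n : ℕ} {G : Subgroup (GL (Fin n) ℝ)}
  {𝔤 : LieSubalgebra ℝ (Matrix (Fin n) (Fin n) ℝ)}

/-- A naturally reductive metric `-K(M ·, ·)` has the property that, for some scalar `c`,
the operator `c M - 1` takes values in a subspace whose adjoint action commutes with `M`. -/
theorem exists_scalar_of_isNaturallyReductive [LieAlgebra.IsSimple ℝ 𝔤]
    (hneg : ∀ x : 𝔤, x ≠ 0 → killingForm ℝ 𝔤 x x < 0)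
    (hG : IsLieAlgebraOf G 𝔤) (m : LinearMap.BilinForm ℝ 𝔤) (M N : 𝔤 →ₗ[ℝ] 𝔤)
    (hm : ∀ X Y, m X Y = -killingForm ℝ 𝔤 (M X) Y)
    (hsymm : ∀ X Y, killingForm ℝ 𝔤 (M X) Y = killingForm ℝ 𝔤 X (M Y))
    (hMN : ∀ X, M (N X) = X) (hNM : ∀ X, N (M X) = X)
    (L : Subgroup G) (h : IsNaturallyReductive hG m L) :
    ∃ c : ℝ, ∀ X Y : 𝔤, ⁅c • M X - X, M Y⁆ = M ⁅c • M X - X, Y⁆ := by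
  obtain ⟨hinv, 𝔩, h𝔩, 𝔪, hdisj, hsup, -, hnat⟩ := h
  -- `M` commutes with `ad V` for `V ∈ 𝔩`
  have hcomm : ∀ V ∈ 𝔩, ∀ Y : 𝔤, ⁅V, M Y⁆ = M ⁅V, Y⁆ := fun V hV =>
    (forall_comm_exp_iff hG M V).1 fun t g hg => by
      obtain ⟨_, ⟨g', hg', rfl⟩, he⟩ := (h𝔩 V).1
        ((LieSubalgebra.mem_map _ _ _).2 ⟨V, hV, rfl⟩) t
      have hgg : g' = g := Subtype.ext (Units.ext (he.trans hg.symm))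
      subst hgg
      exact comm_Ad_of_invariant hG g' (-m) M (fun X Y => by simp [hm])
        fun X Y => by simp [hinv g' hg']
  -- the complement is the graph of a linear map over `𝔤`
  have hle : 𝔪 ≤ Submodule.prod ⊤ 𝔩.toSubmodule := hsup ▸ le_sup_right
  let d : 𝔪 →ₗ[ℝ] 𝔤 := (LinearMap.fst ℝ 𝔤 𝔤 - LinearMap.snd ℝ 𝔤 𝔤) ∘ₗ 𝔪.subtype
  have hd : ∀ p : 𝔪, d p = p.1.1 - p.1.2 := fun _ => rfl
  have hbij : Function.Bijective d := by
    constructor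
    · rw [injective_iff_map_eq_zero]
      intro p hp
      rw [hd, sub_eq_zero] at hp
      have : (p : 𝔤 × 𝔤) ∈ diagonal 𝔩 := by
        refine ⟨p.1.2, (hle p.2).2, ?_⟩
        ext1
        · exact hp.symm
        · rfl
      exact Subtype.ext (Submodule.disjoint_def.1 hdisj _ this p.2)
    · intro X
      have hX : ((X, 0) : 𝔤 × 𝔤) ∈ diagonal 𝔩 ⊔ 𝔪 := by
        rw [hsup]
        exact ⟨trivial, 𝔩.zero_mem⟩
      obtain ⟨_, ⟨V, hV, rfl⟩, p, hp, hVp⟩ := Submodule.mem_sup.1 hX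
      refine ⟨⟨p, hp⟩, ?_⟩
      rw [hd]
      have h1 : V + p.1 = X := congrArg Prod.fst hVp
      have h2 : V + p.2 = 0 := congrArg Prod.snd hVp
      rw [← h1, eq_neg_of_add_eq_zero_right h2]
      abel
  let e := LinearEquiv.ofBijective d hbij
  let S : 𝔤 →ₗ[ℝ] 𝔤 := LinearMap.fst ℝ 𝔤 𝔤 ∘ₗ 𝔪.subtype ∘ₗ e.symm.toLinearMap
  have hSmem : ∀ X, ((S X, S X - X) : 𝔤 × 𝔤) ∈ 𝔪 := fun X => by
    have h1 : (e.symm X).1.1 - (e.symm X).1.2 = X := e.apply_symm_apply X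
    have : ((S X, S X - X) : 𝔤 × 𝔤) = (e.symm X).1 := by
      ext1
      · rfl
      · change (e.symm X).1.1 - X = _
        nth_rewrite 2 [← h1]
        abel
    rw [this]
    exact (e.symm X).2
  have hS𝔩 : ∀ X, S X - X ∈ 𝔩 := fun X => (hle (hSmem X)).2
  -- the condition on the metric says `⁅S Y, M Y⁆ = 0`
  have hSM : ∀ Y, ⁅S Y, M Y⁆ = 0 := fun Y => eq_of_killingForm_eq fun X => by
    have h1 := hnat _ (hSmem X) _ (hSmem Y) _ (hSmem Y)
    have ho : ∀ U V : 𝔤, orbitDiff ⁅((S U, S U - U) : 𝔤 × 𝔤), (S V, S V - V)⁆ =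
        ⁅S U - U, V⁆ + ⁅U, S V⁆ := fun U V => by
      change ⁅S U, S V⁆ - ⁅S U - U, S V - V⁆ = _
      simp only [sub_lie, lie_sub]
      abel
    have ho' : ∀ U : 𝔤, orbitDiff ((S U, S U - U) : 𝔤 × 𝔤) = U := fun U => by
      simp [orbitDiff]
    have h2 : killingForm ℝ 𝔤 ⁅S X - X, M Y⁆ Y = 0 := by
      have h3 : killingForm ℝ 𝔤 ⁅S X - X, M Y⁆ Y = -killingForm ℝ 𝔤 ⁅S X - X, M Y⁆ Y := by
        conv_lhs => rw [← lie_skew, map_neg, LinearMap.neg_apply, killingForm_lie_left, hsymm,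
          ← hcomm _ (hS𝔩 X), killingForm_symm]
      linarith
    rw [ho, ho', hm, hm, killingForm_symm (M Y), ← hsymm, map_add, ← hcomm _ (hS𝔩 X), map_add,
      LinearMap.add_apply, h2, hsymm ⁅X, S Y⁆, killingForm_lie_left] at h1
    rw [killingForm_symm]
    simp only [map_zero, LinearMap.zero_apply]
    linarith
  -- hence `S ∘ M⁻¹` is a homothety
  obtain ⟨c, hc⟩ := exists_eq_smul_of_lie_self_eq_zero hneg (S ∘ₗ N) fun y => by
    have := hSM (N y)
    rwa [hMN] at this
  refine ⟨c, fun X => ?_⟩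
  have hSX : S X = c • M X := by simpa [hNM] using hc (M X)
  rw [← hSX]
  exact hcomm _ (hS𝔩 X)

/-- If the adjoint action of `c M - 1` commutes with `M` for some scalar `c`, the metric
`-K(M ·, ·)` is naturally reductive with respect to the group of all `g` for which `Ad(g)`
commutes with `M`; the complement is `{(c M X, c M X - X)}`. -/
theorem exists_isNaturallyReductive (hG : IsLieAlgebraOf G 𝔤) (m : LinearMap.BilinForm ℝ 𝔤)
    (M : 𝔤 →ₗ[ℝ] 𝔤) (hm : ∀ X Y, m X Y = -killingForm ℝ 𝔤 (M X) Y)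
    (hsymm : ∀ X Y, killingForm ℝ 𝔤 (M X) Y = killingForm ℝ 𝔤 X (M Y)) (c : ℝ)
    (h : ∀ X Y : 𝔤, ⁅c • M X - X, M Y⁆ = M ⁅c • M X - X, Y⁆) :
    ∃ L : Subgroup G, IsClosed (L : Set G) ∧ IsNaturallyReductive hG m L := by
  have hAdmul : ∀ g g' X, Ad hG (g * g') X = Ad hG g (Ad hG g' X) := fun g g' X =>
    Subtype.ext (by simp [coe_Ad, mul_assoc])
  have hAd1 : ∀ X, Ad hG 1 X = X := fun X => Subtype.ext (by simp [coe_Ad])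
  let L : Subgroup G :=
    { carrier := {g | ∀ Y, Ad hG g (M Y) = M (Ad hG g Y)}
      one_mem' := fun Y => by rw [hAd1, hAd1]
      mul_mem' := fun {a b} ha hb Y => by rw [hAdmul, hb, ha, hAdmul]
      inv_mem' := fun {a} ha Y => by
        have := ha (Ad hG a⁻¹ Y)
        rw [← hAdmul a a⁻¹, mul_inv_cancel, hAd1] at this
        rw [← this, ← hAdmul, inv_mul_cancel, hAd1] }
  have hL : ∀ g, g ∈ L ↔ ∀ Y, Ad hG g (M Y) = M (Ad hG g Y) := fun g => Iff.rfl
  let 𝔩 : LieSubalgebra ℝ 𝔤 :=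
    { carrier := {V | ∀ Y : 𝔤, ⁅V, M Y⁆ = M ⁅V, Y⁆}
      add_mem' := fun {a b} ha hb Y => by rw [add_lie, add_lie, ha, hb, map_add]
      zero_mem' := fun Y => by simp
      smul_mem' := fun r {a} ha Y => by rw [smul_lie, smul_lie, ha, map_smul]
      lie_mem' := fun {a b} ha hb Y => by
        rw [lie_lie, lie_lie, ha, hb, ha, hb, map_sub] }
  have h𝔩 : ∀ V, V ∈ 𝔩 ↔ ∀ Y : 𝔤, ⁅V, M Y⁆ = M ⁅V, Y⁆ := fun V => Iff.rfl
  refine ⟨L, isClosed_commutant hG M, fun g hg X Y => ?_, 𝔩,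
    isLieAlgebraOf_commutant hG M L hL 𝔩 h𝔩, ?_⟩
  · rw [hm, hm, ← (hL g).1 hg, killingForm_Ad]
  let φ : 𝔤 →ₗ[ℝ] 𝔤 × 𝔤 := LinearMap.prod (c • M) (c • M - LinearMap.id)
  have hφ : ∀ X, φ X = (c • M X, c • M X - X) := fun X => rfl
  refine ⟨LinearMap.range φ, ?_, ?_, ?_, ?_⟩
  · rw [Submodule.disjoint_def]
    rintro _ ⟨V, -, rfl⟩ ⟨X, hX⟩
    rw [hφ] at hX
    have h1 : c • M X = V := congrArg Prod.fst hX
    have h2 : c • M X - X = V := congrArg Prod.snd hX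
    have hX0 : X = 0 := by rw [← sub_sub_cancel (c • M X) X, h2, h1, sub_self]
    rw [hX0, map_zero, smul_zero] at h1
    rw [← h1]
    simp
  · apply le_antisymm
    · rw [sup_le_iff]
      constructor
      · rintro _ ⟨V, hV, rfl⟩
        exact ⟨trivial, hV⟩
      · rintro _ ⟨X, rfl⟩
        exact ⟨trivial, (h𝔩 _).2 (h X)⟩
    · rintro ⟨X, Y⟩ ⟨-, hY : Y ∈ 𝔩⟩
      refine Submodule.mem_sup.2 ⟨(X - c • M (X - Y), X - c • M (X - Y)),
        ⟨X - c • M (X - Y), ?_, rfl⟩, φ (X - Y), ⟨_, rfl⟩, ?_⟩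
      · have : X - c • M (X - Y) = Y - (c • M (X - Y) - (X - Y)) := by abel
        rw [this]
        exact 𝔩.sub_mem hY ((h𝔩 _).2 (h (X - Y)))
      · rw [hφ, Prod.mk_add_mk]
        ext1 <;> simp
  · rintro g hg _ ⟨X, rfl⟩
    refine ⟨Ad hG g X, ?_⟩
    have hsub : ∀ X Y, Ad hG g (X - Y) = Ad hG g X - Ad hG g Y := (adEquiv hG g).map_sub
    have hsmul : ∀ (c : ℝ) X, Ad hG g (c • X) = c • Ad hG g X := (adEquiv hG g).map_smul
    simp only [hφ, hsub, hsmul, (hL g).1 hg]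
  · rintro _ ⟨X, rfl⟩ _ ⟨Y, rfl⟩ _ ⟨W, rfl⟩
    have ho : ∀ U V : 𝔤, orbitDiff ⁅φ U, φ V⁆ = ⁅c • M U - U, V⁆ + c • ⁅U, M V⁆ := fun U V => by
      change ⁅c • M U, c • M V⁆ - ⁅c • M U - U, c • M V - V⁆ = _
      simp only [sub_lie, lie_sub, smul_lie, lie_smul]
      module
    have ho' : ∀ U : 𝔤, orbitDiff (φ U) = U := fun U => by simp [orbitDiff, hφ]
    rw [ho, ho', ho, ho', hm, hm, hsymm, killingForm_symm (M Y)]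
    simp only [map_add, LinearMap.add_apply, map_smul, LinearMap.smul_apply]
    have e1 : killingForm ℝ 𝔤 ⁅X, M Y⁆ (M W) = -killingForm ℝ 𝔤 ⁅X, M W⁆ (M Y) := by
      rw [killingForm_lie_left, killingForm_lie_left, ← lie_skew (M Y) (M W), map_neg]
    have e2 : killingForm ℝ 𝔤 ⁅c • M X - X, Y⁆ (M W) =
        -killingForm ℝ 𝔤 ⁅c • M X - X, W⁆ (M Y) := by
      rw [← hsymm, ← h, ← lie_skew, map_neg, LinearMap.neg_apply, killingForm_lie_left,
        killingForm_symm]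
    rw [e1, e2]
    simp only [smul_eq_mul]
    ring

end Criterion
/-! ### The grading defined by an element of the Lie algebra -/

section Grading

variable {𝔤 : Type*} [LieRing 𝔤] [LieAlgebra ℝ 𝔤]

/-- The space on which `(ad Z)²` acts as `-r²`. In the complexification it is the sum of the
eigenspaces of `ad Z` for `± i r`. -/
def gradingSpace (Z : 𝔤) (r : ℝ) : Submodule ℝ 𝔤 :=
  LinearMap.ker (LieAlgebra.ad ℝ 𝔤 Z ∘ₗ LieAlgebra.ad ℝ 𝔤 Z + r ^ 2 • LinearMap.id)

theorem mem_gradingSpace {Z : 𝔤} {r : ℝ} {X : 𝔤} :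
    X ∈ gradingSpace Z r ↔ ⁅Z, ⁅Z, X⁆⁆ = -(r ^ 2 • X) := by
  simp [gradingSpace, add_eq_zero_iff_eq_neg]

theorem gradingSpace_neg (Z : 𝔤) (r : ℝ) : gradingSpace Z (-r) = gradingSpace Z r := by
  simp [gradingSpace]

/-- If `(ad Z)²` satisfies `(T + r²) (T + s²) W = 0`, then `W` splits into eigenvectors. -/
theorem mem_sup_of_quadratic {Z W : 𝔤} {r s : ℝ} (hrs : r ^ 2 ≠ s ^ 2)
    (h : ⁅Z, ⁅Z, ⁅Z, ⁅Z, W⁆⁆⁆⁆ = -((r ^ 2 + s ^ 2) • ⁅Z, ⁅Z, W⁆⁆) - (r ^ 2 * s ^ 2) • W) :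
    W ∈ gradingSpace Z r ⊔ gradingSpace Z s := by
  have hne : r ^ 2 - s ^ 2 ≠ 0 := sub_ne_zero.2 hrs
  refine Submodule.mem_sup.2
    ⟨-(r ^ 2 - s ^ 2)⁻¹ • (⁅Z, ⁅Z, W⁆⁆ + s ^ 2 • W), ?_,
      (r ^ 2 - s ^ 2)⁻¹ • (⁅Z, ⁅Z, W⁆⁆ + r ^ 2 • W), ?_, ?_⟩
  · rw [mem_gradingSpace]
    simp only [lie_smul, lie_add, h]
    module
  · rw [mem_gradingSpace]
    simp only [lie_smul, lie_add, h]
    module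
  · have : W = ((r ^ 2 - s ^ 2)⁻¹ * (r ^ 2 - s ^ 2)) • W := by
      rw [inv_mul_cancel₀ hne, one_smul]
    conv_rhs => rw [this]
    module

theorem lie_mem_gradingSpace_of_comm {Z V X : 𝔤} {r : ℝ} (hV : ⁅Z, V⁆ = 0)
    (hX : X ∈ gradingSpace Z r) : ⁅V, X⁆ ∈ gradingSpace Z r := by
  rw [mem_gradingSpace] at hX ⊢
  have h : ∀ Y : 𝔤, ⁅Z, ⁅V, Y⁆⁆ = ⁅V, ⁅Z, Y⁆⁆ := fun Y => by
    rw [leibniz_lie, hV, zero_lie, zero_add]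
  rw [h, h, hX, lie_neg, lie_smul]

/-- The complexification of this statement adds up the eigenvalues `± i r` and `± i s`. -/
theorem lie_mem_gradingSpace_sup {Z X Y : 𝔤} {r s : ℝ} (hr : r ≠ 0) (hs : s ≠ 0)
    (hX : X ∈ gradingSpace Z r) (hY : Y ∈ gradingSpace Z s) :
    ⁅X, Y⁆ ∈ gradingSpace Z (r + s) ⊔ gradingSpace Z (r - s) := by
  rw [mem_gradingSpace] at hX hY
  refine mem_sup_of_quadratic (fun h => mul_ne_zero hr hs (by linarith)) ?_
  have hD : ∀ A B : 𝔤, ⁅Z, ⁅Z, ⁅A, B⁆⁆⁆ =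
      ⁅⁅Z, ⁅Z, A⁆⁆, B⁆ + (2 : ℝ) • ⁅⁅Z, A⁆, ⁅Z, B⁆⁆ + ⁅A, ⁅Z, ⁅Z, B⁆⁆⁆ := fun A B => by
    rw [leibniz_lie Z A B, lie_add, leibniz_lie Z ⁅Z, A⁆ B, leibniz_lie Z A ⁅Z, B⁆]
    module
  have h1 : ⁅Z, ⁅Z, ⁅X, Y⁆⁆⁆ = -((r ^ 2 + s ^ 2) • ⁅X, Y⁆) + (2 : ℝ) • ⁅⁅Z, X⁆, ⁅Z, Y⁆⁆ := by
    rw [hD, hX, hY, neg_lie, lie_neg, smul_lie, lie_smul]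
    module
  have h2 : ⁅Z, ⁅Z, ⁅⁅Z, X⁆, ⁅Z, Y⁆⁆⁆⁆ = -((r ^ 2 + s ^ 2) • ⁅⁅Z, X⁆, ⁅Z, Y⁆⁆) +
      (2 * r ^ 2 * s ^ 2) • ⁅X, Y⁆ := by
    rw [hD, hX, hY]
    simp only [neg_lie, lie_neg, smul_lie, lie_smul]
    module
  rw [h1]
  simp only [lie_add, lie_neg, lie_smul, h1, h2]
  module

theorem killingForm_eq_zero_of_mem_gradingSpace {Z X Y : 𝔤} {r s : ℝ} (hrs : r ^ 2 ≠ s ^ 2)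
    (hX : X ∈ gradingSpace Z r) (hY : Y ∈ gradingSpace Z s) : killingForm ℝ 𝔤 X Y = 0 := by
  rw [mem_gradingSpace] at hX hY
  have h1 : killingForm ℝ 𝔤 ⁅Z, ⁅Z, X⁆⁆ Y = killingForm ℝ 𝔤 X ⁅Z, ⁅Z, Y⁆⁆ := by
    rw [← lie_skew Z ⁅Z, X⁆, ← lie_skew Z X]
    simp only [neg_lie, neg_neg, killingForm_lie_left]
  rw [hX, hY] at h1
  simp only [map_neg, map_smul, LinearMap.neg_apply, LinearMap.smul_apply, smul_eq_mul] at h1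
  have : (r ^ 2 - s ^ 2) * killingForm ℝ 𝔤 X Y = 0 := by linarith
  exact (mul_eq_zero.1 this).resolve_left (sub_ne_zero.2 hrs)

/-- As `ad Z` is skew for a definite form, `(ad Z)² X = 0` implies `⁅Z, X⁆ = 0`. -/
theorem mem_gradingSpace_zero (hneg : ∀ x : 𝔤, x ≠ 0 → killingForm ℝ 𝔤 x x < 0) {Z X : 𝔤} :
    X ∈ gradingSpace Z 0 ↔ ⁅Z, X⁆ = 0 := by
  rw [mem_gradingSpace]
  refine ⟨fun h => ?_, fun h => by simp [h]⟩
  by_contra h0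
  have h1 := hneg _ h0
  have h2 : killingForm ℝ 𝔤 ⁅Z, X⁆ ⁅Z, X⁆ = -killingForm ℝ 𝔤 X ⁅Z, ⁅Z, X⁆⁆ :=
    killingForm_lie_skew Z X _
  simp [h2, h] at h1

/-- The centre of the centralizer `𝔨` of `Z`, its derived algebra, and the spaces on which
`(ad Z)²` acts by `-1`, `-4`, `-9`. -/
def gradedComponent (Z : 𝔤) : Fin 5 → Submodule ℝ 𝔤 :=
  ![gradingSpace Z 0 ⊓ ⨅ Y ∈ gradingSpace Z 0, LinearMap.ker (LieAlgebra.ad ℝ 𝔤 Y),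
    Submodule.span ℝ {W | ∃ X ∈ gradingSpace Z 0, ∃ Y ∈ gradingSpace Z 0, ⁅X, Y⁆ = W},
    gradingSpace Z 1, gradingSpace Z 2, gradingSpace Z 3]

theorem mem_gradedComponent_zero {Z X : 𝔤} :
    X ∈ gradedComponent Z 0 ↔ X ∈ gradingSpace Z 0 ∧ ∀ Y ∈ gradingSpace Z 0, ⁅Y, X⁆ = 0 := by
  simp [gradedComponent, Submodule.mem_iInf]

theorem lie_mem_gradedComponent_one {Z X Y : 𝔤} (hX : X ∈ gradingSpace Z 0)
    (hY : Y ∈ gradingSpace Z 0) : ⁅X, Y⁆ ∈ gradedComponent Z 1 :=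
  Submodule.subset_span ⟨X, hX, Y, hY, rfl⟩

variable (hneg : ∀ x : 𝔤, x ≠ 0 → killingForm ℝ 𝔤 x x < 0)
include hneg

theorem gradedComponent_one_le {Z : 𝔤} : gradedComponent Z 1 ≤ gradingSpace Z 0 := by
  refine Submodule.span_le.2 ?_
  rintro _ ⟨X, hX, Y, hY, rfl⟩
  exact lie_mem_gradingSpace_of_comm ((mem_gradingSpace_zero hneg).1 hX) hY

theorem self_mem_gradedComponent {Z : 𝔤} : Z ∈ gradedComponent Z 0 := by
  rw [mem_gradedComponent_zero, mem_gradingSpace_zero hneg]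
  refine ⟨lie_self Z, fun Y hY => ?_⟩
  rw [← lie_skew, (mem_gradingSpace_zero hneg).1 hY, neg_zero]

/-- An element of `𝔨` orthogonal to `[𝔨, 𝔨]` is central in `𝔨`. -/
theorem mem_gradedComponent_zero_of_orthogonal {Z X : 𝔤} (hX : X ∈ gradingSpace Z 0)
    (h : ∀ W ∈ gradedComponent Z 1, killingForm ℝ 𝔤 X W = 0) : X ∈ gradedComponent Z 0 := by
  rw [mem_gradedComponent_zero]
  refine ⟨hX, fun Y hY => ?_⟩
  by_contra h0
  refine (hneg _ h0).ne ?_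
  have hYX : ⁅Y, X⁆ ∈ gradingSpace Z 0 :=
    lie_mem_gradingSpace_of_comm ((mem_gradingSpace_zero hneg).1 hY) hX
  rw [killingForm_lie_skew, h _ (lie_mem_gradedComponent_one hY hYX), neg_zero]

theorem killingForm_gradedComponent {Z : 𝔤} {i j : Fin 5} (hij : i ≠ j) {X Y : 𝔤}
    (hX : X ∈ gradedComponent Z i) (hY : Y ∈ gradedComponent Z j) : killingForm ℝ 𝔤 X Y = 0 := by
  have h01 : ∀ X ∈ gradedComponent Z 0, ∀ Y ∈ gradedComponent Z 1, killingForm ℝ 𝔤 X Y = 0 := by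
    intro X hX
    change gradedComponent Z 1 ≤ LinearMap.ker (killingForm ℝ 𝔤 X)
    refine Submodule.span_le.2 ?_
    rintro _ ⟨V, hV, W, hW, rfl⟩
    change killingForm ℝ 𝔤 X ⁅V, W⁆ = 0
    have h := killingForm_lie_skew V X W
    rw [(mem_gradedComponent_zero.1 hX).2 V hV] at h
    simpa using h
  have hle : ∀ i : Fin 5, gradedComponent Z i ≤ gradingSpace Z (![0, 0, 1, 2, 3] i) := by
    intro i
    fin_cases i
    · exact inf_le_left
    · exact gradedComponent_one_le hneg
    all_goals exact le_rfl
  by_cases hd : (![0, 0, 1, 2, 3] i : ℝ) ^ 2 = (![0, 0, 1, 2, 3] j : ℝ) ^ 2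
  · have hc : i = 0 ∧ j = 1 ∨ i = 1 ∧ j = 0 := by
      fin_cases i <;> fin_cases j <;> norm_num at hd <;> simp at hij ⊢
    rcases hc with ⟨rfl, rfl⟩ | ⟨rfl, rfl⟩
    · exact h01 _ hX _ hY
    · rw [killingForm_symm]
      exact h01 _ hY _ hX
  · exact killingForm_eq_zero_of_mem_gradingSpace hd (hle i hX) (hle j hY)

/-- `𝔨` is the sum of its centre and its derived algebra: the orthogonal complement of the derived
algebra is central. -/
theorem gradingSpace_zero_le_sup [Module.Finite ℝ 𝔤] {Z : 𝔤} :
    gradingSpace Z 0 ≤ gradedComponent Z 0 ⊔ gradedComponent Z 1 := by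
  intro X hX
  have hc : IsCompl (gradedComponent Z 1) ((killingForm ℝ 𝔤).orthogonal (gradedComponent Z 1)) := by
    rw [LinearMap.BilinForm.isCompl_orthogonal_iff_disjoint
      (LieModule.traceForm_isSymm ℝ 𝔤 𝔤).isRefl, Submodule.disjoint_def]
    intro W hW hW'
    by_contra h0
    exact (hneg W h0).ne (hW' W hW)
  obtain ⟨V, hV, W, hW, rfl⟩ := Submodule.mem_sup.1
    (hc.sup_eq_top ▸ Submodule.mem_top : X ∈ _ ⊔ (killingForm ℝ 𝔤).orthogonal _)
  rw [sup_comm]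
  refine Submodule.add_mem_sup hV (mem_gradedComponent_zero_of_orthogonal hneg ?_ fun U hU => ?_)
  · simpa using (gradingSpace Z 0).sub_mem hX (gradedComponent_one_le hneg hV)
  · rw [killingForm_symm]
    exact hW U hU

end Grading

/-! ### Operators that are scalar on the graded components -/

section DiagonalOperators

variable {𝔤 : Type*} [LieRing 𝔤] [LieAlgebra ℝ 𝔤]

/-- The operator `M` acts on the five components as multiplication by `c₀, …, c₄`. -/
def IsDiagonalOperator (Z : 𝔤) (M : 𝔤 →ₗ[ℝ] 𝔤) (c : Fin 5 → ℝ) : Prop :=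
  ∀ i, gradedComponent Z i ≤ Module.End.eigenspace M (c i)

/-- The operator `M` commutes with `ad V`. -/
def CommutesWithAd (M : 𝔤 →ₗ[ℝ] 𝔤) (V : 𝔤) : Prop := ∀ Y : 𝔤, ⁅V, M Y⁆ = M ⁅V, Y⁆

theorem IsDiagonalOperator.apply {Z : 𝔤} {M : 𝔤 →ₗ[ℝ] 𝔤} {c : Fin 5 → ℝ}
    (hM : IsDiagonalOperator Z M c) {i : Fin 5} {X : 𝔤} (hX : X ∈ gradedComponent Z i) :
    M X = c i • X := Module.End.mem_eigenspace_iff.1 (hM i hX)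

variable {Z : 𝔤} {M : 𝔤 →ₗ[ℝ] 𝔤} {c : Fin 5 → ℝ}

theorem eq_of_eq_on_components {W : Type*} [AddCommGroup W] [Module ℝ W]
    (htop : ⨆ i, gradedComponent Z i = ⊤)
    {φ ψ : 𝔤 →ₗ[ℝ] W} (h : ∀ i, ∀ X ∈ gradedComponent Z i, φ X = ψ X) : φ = ψ := by
  rw [← LinearMap.eqLocus_eq_top, eq_top_iff, ← htop, iSup_le_iff]
  exact h

theorem commutesWithAd_of_forall_component (htop : ⨆ i, gradedComponent Z i = ⊤)
    (hM : IsDiagonalOperator Z M c) {V : 𝔤}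
    (h : ∀ i, ∀ Y ∈ gradedComponent Z i, ⁅V, Y⁆ ∈ Module.End.eigenspace M (c i)) :
    CommutesWithAd M V := by
  have : LieAlgebra.ad ℝ 𝔤 V ∘ₗ M = M ∘ₗ LieAlgebra.ad ℝ 𝔤 V :=
    eq_of_eq_on_components htop fun i Y hY => by
      change ⁅V, M Y⁆ = M ⁅V, Y⁆
      rw [hM.apply hY, lie_smul, Module.End.mem_eigenspace_iff.1 (h i Y hY)]
  exact fun Y => LinearMap.congr_fun this Y

/-- The adjoint action of `r M - 1` commutes with `M` if and only if each component on which
`r M ≠ 1` does so. -/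
theorem forall_comm_sub_iff (htop : ⨆ i, gradedComponent Z i = ⊤)
    (hM : IsDiagonalOperator Z M c) (r : ℝ) :
    (∀ X Y : 𝔤, ⁅r • M X - X, M Y⁆ = M ⁅r • M X - X, Y⁆) ↔
      ∀ i, r * c i = 1 ∨ ∀ V ∈ gradedComponent Z i, CommutesWithAd M V := by
  have hval : ∀ i, ∀ X ∈ gradedComponent Z i, r • M X - X = (r * c i - 1) • X := fun i X hX => by
    rw [hM.apply hX]
    module
  constructor
  · intro h i
    refine or_iff_not_imp_left.2 fun hi V hV Y => ?_
    have h1 := h V Y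
    rw [hval i V hV, smul_lie, smul_lie, map_smul] at h1
    exact smul_right_injective 𝔤 (sub_ne_zero.2 hi) h1
  · intro h X Y
    let φ : 𝔤 →ₗ[ℝ] 𝔤 := r • M - LinearMap.id
    have key : (LieModule.toEnd ℝ 𝔤 𝔤 : 𝔤 →ₗ[ℝ] Module.End ℝ 𝔤).flip (M Y) ∘ₗ φ =
        M ∘ₗ (LieModule.toEnd ℝ 𝔤 𝔤 : 𝔤 →ₗ[ℝ] Module.End ℝ 𝔤).flip Y ∘ₗ φ :=
      eq_of_eq_on_components htop fun i V hV => by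
        change ⁅r • M V - V, M Y⁆ = M ⁅r • M V - V, Y⁆
        rw [hval i V hV, smul_lie, smul_lie, map_smul]
        rcases h i with hi | hi
        · rw [hi]
          simp
        · rw [hi V hV]
    exact LinearMap.congr_fun key X

theorem exists_inverse [Module.Finite ℝ 𝔤] (htop : ⨆ i, gradedComponent Z i = ⊤)
    (hM : IsDiagonalOperator Z M c) (hc : ∀ i, c i ≠ 0) :
    ∃ N : 𝔤 →ₗ[ℝ] 𝔤, (∀ X, M (N X) = X) ∧ ∀ X, N (M X) = X := by
  have hsurj : Function.Surjective M := by
    rw [← LinearMap.range_eq_top, eq_top_iff, ← htop, iSup_le_iff]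
    exact fun i X hX => ⟨(c i)⁻¹ • X, by rw [map_smul, hM.apply hX, inv_smul_smul₀ (hc i)]⟩
  let e := LinearEquiv.ofBijective M ⟨LinearMap.injective_iff_surjective.2 hsurj, hsurj⟩
  exact ⟨e.symm.toLinearMap, e.apply_symm_apply, e.symm_apply_apply⟩

/-- Distinct grading spaces are orthogonal, and nothing is orthogonal to those for `0, …, 3`. -/
theorem gradingSpace_eq_bot [Module.Finite ℝ 𝔤] [LieAlgebra.IsKilling ℝ 𝔤]
    (htop : gradingSpace Z 0 ⊔ gradingSpace Z 1 ⊔ gradingSpace Z 2 ⊔ gradingSpace Z 3 = ⊤)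
    {r : ℝ} (hr : 3 < r) : gradingSpace Z r = ⊥ := by
  rw [eq_bot_iff]
  intro X hX
  refine (Submodule.mem_bot ℝ).2 (eq_of_killingForm_eq fun Y => ?_)
  have hle : (⊤ : Submodule ℝ 𝔤) ≤ LinearMap.ker (killingForm ℝ 𝔤 X) := by
    rw [← htop]
    have h : ∀ s : ℝ, 0 ≤ s → s ≤ 3 → gradingSpace Z s ≤ LinearMap.ker (killingForm ℝ 𝔤 X) :=
      fun s hs hs' Y hY => killingForm_eq_zero_of_mem_gradingSpace (by nlinarith) hX hY
    exact sup_le (sup_le (sup_le (h 0 le_rfl (by norm_num)) (h 1 (by norm_num) (by norm_num)))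
      (h 2 (by norm_num) (by norm_num))) (h 3 (by norm_num) le_rfl)
  simpa using hle (Submodule.mem_top : Y ∈ ⊤)

variable (hneg : ∀ x : 𝔤, x ≠ 0 → killingForm ℝ 𝔤 x x < 0)
include hneg

theorem IsDiagonalOperator.killingForm_symm (htop : ⨆ i, gradedComponent Z i = ⊤)
    (hM : IsDiagonalOperator Z M c) (X Y : 𝔤) :
    killingForm ℝ 𝔤 (M X) Y = killingForm ℝ 𝔤 X (M Y) := by
  have : (killingForm ℝ 𝔤) ∘ₗ M = (killingForm ℝ 𝔤).compl₂ M :=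
    eq_of_eq_on_components htop fun i X hX => eq_of_eq_on_components htop fun j Y hY => by
      simp only [LinearMap.comp_apply, LinearMap.compl₂_apply, hM.apply hX, hM.apply hY, map_smul,
        LinearMap.smul_apply]
      rcases eq_or_ne i j with rfl | hij
      · rfl
      · rw [killingForm_gradedComponent hneg hij hX hY, smul_zero, smul_zero]
  exact LinearMap.congr_fun₂ this X Y

theorem exists_diagonalOperator [Module.Finite ℝ 𝔤] [LieAlgebra.IsKilling ℝ 𝔤]
    (htop : ⨆ i, gradedComponent Z i = ⊤) (m : LinearMap.BilinForm ℝ 𝔤)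
    (hm : ∀ i j : Fin 5, ∀ X ∈ gradedComponent Z i, ∀ Y ∈ gradedComponent Z j,
      m X Y = if i = j then c i * -(killingForm ℝ 𝔤 X Y) else 0) :
    ∃ M : 𝔤 →ₗ[ℝ] 𝔤, IsDiagonalOperator Z M c ∧ ∀ X Y, m X Y = -killingForm ℝ 𝔤 (M X) Y := by
  obtain ⟨M, hM⟩ := exists_operator_of_bilin (-m)
  have hM' : ∀ X Y, m X Y = -killingForm ℝ 𝔤 (M X) Y := fun X Y => by
    rw [← hM, LinearMap.neg_apply, LinearMap.neg_apply, neg_neg]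
  refine ⟨M, fun i X hX => Module.End.mem_eigenspace_iff.2 ?_, hM'⟩
  refine eq_of_killingForm_eq fun W => ?_
  have : killingForm ℝ 𝔤 (M X) = killingForm ℝ 𝔤 (c i • X) :=
    eq_of_eq_on_components htop fun j Y hY => by
      rw [← neg_inj, ← hM', hm i j X hX Y hY, map_smul, LinearMap.smul_apply, smul_eq_mul]
      split_ifs with hij
      · ring
      · rw [killingForm_gradedComponent hneg hij hX hY]
        simp
  rw [this]

theorem iSup_gradedComponent_eq_top [Module.Finite ℝ 𝔤]
    (htop : gradingSpace Z 0 ⊔ gradingSpace Z 1 ⊔ gradingSpace Z 2 ⊔ gradingSpace Z 3 = ⊤) :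
    ⨆ i, gradedComponent Z i = ⊤ := by
  rw [eq_top_iff, ← htop]
  have h := le_iSup (gradedComponent Z)
  exact sup_le (sup_le (sup_le ((gradingSpace_zero_le_sup hneg).trans (sup_le (h 0) (h 1)))
    (h 2)) (h 3)) (h 4)

end DiagonalOperators

/-! ### Components that commute with a diagonal operator -/

section Commutation

open Module.End (eigenspace mem_eigenspace_iff)

variable {𝔤 : Type*} [LieRing 𝔤] [LieAlgebra ℝ 𝔤]
  {Z : 𝔤} {M : 𝔤 →ₗ[ℝ] 𝔤} {c : Fin 5 → ℝ}

section Necessary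

variable (hM : IsDiagonalOperator Z M c)
include hM

theorem eq_of_commutesWithAd_of_lie_ne_zero {i j : Fin 5} {V Y : 𝔤} (hV : CommutesWithAd M V)
    (hY : Y ∈ gradedComponent Z i) (hVY : ⁅V, Y⁆ ∈ gradedComponent Z j) (h0 : ⁅V, Y⁆ ≠ 0) :
    c i = c j := by
  have h := hV Y
  rw [hM.apply hY, lie_smul, hM.apply hVY] at h
  exact smul_left_injective ℝ h0 h

/-- The variant in which `⁅V, X⁆` may have further components. -/
theorem eq_of_commutesWithAd_of_killingForm_ne_zero [Module.Finite ℝ 𝔤]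
    (hsymm : ∀ X Y, killingForm ℝ 𝔤 (M X) Y = killingForm ℝ 𝔤 X (M Y))
    {i j : Fin 5} {V X Y : 𝔤} (hV : CommutesWithAd M V)
    (hX : X ∈ gradedComponent Z i) (hY : Y ∈ gradedComponent Z j)
    (h0 : killingForm ℝ 𝔤 ⁅V, X⁆ Y ≠ 0) : c i = c j := by
  have h := hsymm ⁅V, X⁆ Y
  rw [← hV, hM.apply hX, hM.apply hY, lie_smul, map_smul, map_smul, LinearMap.smul_apply] at h
  exact mul_right_cancel₀ h0 h

end Necessary

section Sufficient

variable [Module.Finite ℝ 𝔤] [LieAlgebra.IsKilling ℝ 𝔤]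
  (hneg : ∀ x : 𝔤, x ≠ 0 → killingForm ℝ 𝔤 x x < 0)
  (htop : gradingSpace Z 0 ⊔ gradingSpace Z 1 ⊔ gradingSpace Z 2 ⊔ gradingSpace Z 3 = ⊤)
include htop

/-- As there are no components of degree more than `3`, only the difference of the degrees can
occur in the bracket. -/
theorem lie_mem_gradingSpace_sub {X Y : 𝔤} {r s t : ℝ} (hr : 0 < r) (hs : 0 < s)
    (hrs : 3 < r + s) (ht : t = r - s ∨ t = s - r) (hX : X ∈ gradingSpace Z r)
    (hY : Y ∈ gradingSpace Z s) : ⁅X, Y⁆ ∈ gradingSpace Z t := by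
  have h := lie_mem_gradingSpace_sup hr.ne' hs.ne' hX hY
  rw [gradingSpace_eq_bot htop hrs, bot_sup_eq] at h
  rcases ht with rfl | rfl
  · exact h
  · rwa [← neg_sub, gradingSpace_neg]

include hneg

omit [Module.Finite ℝ 𝔤] [LieAlgebra.IsKilling ℝ 𝔤] htop in
theorem lie_mem_gradingSpace_of_zero {V Y : 𝔤} {r : ℝ} (hV : V ∈ gradingSpace Z r)
    (hY : Y ∈ gradingSpace Z 0) : ⁅V, Y⁆ ∈ gradingSpace Z r := by
  rw [← lie_skew]
  exact Submodule.neg_mem _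
    (lie_mem_gradingSpace_of_comm ((mem_gradingSpace_zero hneg).1 hY) hV)

variable (hM : IsDiagonalOperator Z M c)
include hM

omit [LieAlgebra.IsKilling ℝ 𝔤] htop in
theorem gradingSpace_zero_le_eigenspace (h : c 0 = c 1) :
    gradingSpace Z 0 ≤ eigenspace M (c 0) :=
  (gradingSpace_zero_le_sup hneg).trans (sup_le (hM 0) (h ▸ hM 1))

omit [LieAlgebra.IsKilling ℝ 𝔤] in
theorem commutesWithAd_of_mem_zero {V : 𝔤} (hV : V ∈ gradingSpace Z 0) : CommutesWithAd M V := by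
  refine commutesWithAd_of_forall_component (iSup_gradedComponent_eq_top hneg htop) hM
    fun i Y hY => ?_
  have hZV := (mem_gradingSpace_zero hneg).1 hV
  fin_cases i
  · rw [(mem_gradedComponent_zero.1 hY).2 V hV]
    exact Submodule.zero_mem _
  · exact hM 1 (lie_mem_gradedComponent_one hV (gradedComponent_one_le hneg hY))
  · exact hM 2 (lie_mem_gradingSpace_of_comm hZV hY)
  · exact hM 3 (lie_mem_gradingSpace_of_comm hZV hY)
  · exact hM 4 (lie_mem_gradingSpace_of_comm hZV hY)

theorem commutesWithAd_of_mem_three (h01 : c 0 = c 1) (h14 : c 1 = c 4) (h23 : c 2 = c 3)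
    {V : 𝔤} (hV : V ∈ gradingSpace Z 3) : CommutesWithAd M V := by
  refine commutesWithAd_of_forall_component (iSup_gradedComponent_eq_top hneg htop) hM
    fun i Y hY => ?_
  have h0 := gradingSpace_zero_le_eigenspace hneg hM h01
  fin_cases i
  · exact h01 ▸ h14 ▸ hM 4 (lie_mem_gradingSpace_of_zero hneg hV hY.1)
  · exact h14 ▸ hM 4 (lie_mem_gradingSpace_of_zero hneg hV (gradedComponent_one_le hneg hY))
  · exact h23 ▸ hM 3 (lie_mem_gradingSpace_sub htop (by norm_num) one_pos (by norm_num)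
      (.inl (by norm_num)) hV hY)
  · exact h23 ▸ hM 2 (lie_mem_gradingSpace_sub htop (by norm_num) two_pos (by norm_num)
      (.inl (by norm_num)) hV hY)
  · exact h14 ▸ h01 ▸ h0 (lie_mem_gradingSpace_sub htop (by norm_num) three_pos (by norm_num)
      (.inl (by norm_num)) hV hY)

omit hneg in
theorem lie_mem_eigenspace_of_mem_two (h24 : c 2 = c 4) {V Y : 𝔤} (hV : V ∈ gradingSpace Z 2)
    (hY : Y ∈ gradingSpace Z 1 ∨ Y ∈ gradingSpace Z 3) : ⁅V, Y⁆ ∈ eigenspace M (c 2) := by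
  rcases hY with hY | hY
  · have h := lie_mem_gradingSpace_sup two_ne_zero one_ne_zero hV hY
    norm_num at h
    exact sup_le (h24 ▸ hM 4) (hM 2) h
  · exact hM 2 (lie_mem_gradingSpace_sub htop (by norm_num) three_pos (by norm_num)
      (.inr (by norm_num)) hV hY)

theorem commutesWithAd_of_mem_two (h01 : c 0 = c 1) (h13 : c 1 = c 3) (h24 : c 2 = c 4)
    {V : 𝔤} (hV : V ∈ gradingSpace Z 2) : CommutesWithAd M V := by
  refine commutesWithAd_of_forall_component (iSup_gradedComponent_eq_top hneg htop) hM
    fun i Y hY => ?_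
  have h0 := gradingSpace_zero_le_eigenspace hneg hM h01
  fin_cases i
  · exact h01 ▸ h13 ▸ hM 3 (lie_mem_gradingSpace_of_zero hneg hV hY.1)
  · exact h13 ▸ hM 3 (lie_mem_gradingSpace_of_zero hneg hV (gradedComponent_one_le hneg hY))
  · exact lie_mem_eigenspace_of_mem_two htop hM h24 hV (.inl hY)
  · exact h13 ▸ h01 ▸ h0 (lie_mem_gradingSpace_sub htop two_pos two_pos (by norm_num)
      (.inl (by norm_num)) hV hY)
  · exact h24 ▸ lie_mem_eigenspace_of_mem_two htop hM h24 hV (.inr hY)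

/-- If `[𝔨, 𝔨]` acts trivially on the second summand `𝔭₂`, then `⁅𝔭₂, 𝔭₂⁆` lies in the centre of
`𝔨`, so that the value of `M` on `[𝔨, 𝔨]` does not matter. -/
theorem commutesWithAd_of_mem_two_of_trivial
    (htriv : ∀ W ∈ gradedComponent Z 1, ∀ P ∈ gradingSpace Z 2, ⁅W, P⁆ = 0)
    (h03 : c 0 = c 3) (h24 : c 2 = c 4)
    {V : 𝔤} (hV : V ∈ gradingSpace Z 2) : CommutesWithAd M V := by
  refine commutesWithAd_of_forall_component (iSup_gradedComponent_eq_top hneg htop) hM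
    fun i Y hY => ?_
  fin_cases i
  · exact h03 ▸ hM 3 (lie_mem_gradingSpace_of_zero hneg hV hY.1)
  · rw [← lie_skew, htriv Y hY V hV, neg_zero]
    exact Submodule.zero_mem _
  · exact lie_mem_eigenspace_of_mem_two htop hM h24 hV (.inl hY)
  · refine h03 ▸ hM 0 (mem_gradedComponent_zero_of_orthogonal hneg
      (lie_mem_gradingSpace_sub htop two_pos two_pos (by norm_num) (.inl (by norm_num)) hV hY)
      fun W hW => ?_)
    rw [killingForm_lie_left, ← lie_skew, htriv W hW Y hY]
    simp
  · exact h24 ▸ lie_mem_eigenspace_of_mem_two htop hM h24 hV (.inr hY)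

end Sufficient

/-! ### Classification of the diagonal operators -/

section Classification

variable [Module.Finite ℝ 𝔤] [LieAlgebra.IsKilling ℝ 𝔤]
  (hneg : ∀ x : 𝔤, x ≠ 0 → killingForm ℝ 𝔤 x x < 0)
  (htop : gradingSpace Z 0 ⊔ gradingSpace Z 1 ⊔ gradingSpace Z 2 ⊔ gradingSpace Z 3 = ⊤)
  (hM : IsDiagonalOperator Z M c)
  (h13 : ∃ X ∈ gradingSpace Z 1, ∃ Y ∈ gradingSpace Z 3, ⁅X, Y⁆ ≠ 0)
include hneg htop hM h13

/-- The brackets of `𝔭₁` with `𝔭₂` and `𝔭₃` have components in `𝔭₁` and `𝔭₂`. -/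
theorem eq_of_commutesWithAd_one
    (h12 : ∃ X ∈ gradingSpace Z 1, ∃ Y ∈ gradingSpace Z 2, ⁅X, Y⁆ ∉ gradingSpace Z 3)
    (h : ∀ V ∈ gradingSpace Z 1, CommutesWithAd M V) : c 2 = c 3 ∧ c 3 = c 4 := by
  constructor
  · obtain ⟨X, hX, Y, hY, hXY⟩ := h12
    have hs := lie_mem_gradingSpace_sup two_ne_zero one_ne_zero hY hX
    norm_num at hs
    obtain ⟨P, hP, Q, hQ, hPQ⟩ := Submodule.mem_sup.1 hs
    have hXY' : ⁅X, Y⁆ = -(P + Q) := by rw [hPQ, lie_skew]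
    have hQ0 : Q ≠ 0 := fun h0 => hXY (by
      rw [hXY', h0, add_zero]
      exact Submodule.neg_mem _ hP)
    refine (eq_of_commutesWithAd_of_killingForm_ne_zero hM (i := 3) (j := 2) (Y := Q)
      (hM.killingForm_symm hneg (iSup_gradedComponent_eq_top hneg htop)) (h X hX) hY hQ ?_).symm
    have hPQ0 : killingForm ℝ 𝔤 P Q = 0 :=
      killingForm_eq_zero_of_mem_gradingSpace (by norm_num) hP hQ
    rw [hXY', map_neg, LinearMap.neg_apply, map_add, LinearMap.add_apply, hPQ0, zero_add,
      neg_ne_zero]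
    exact (hneg Q hQ0).ne
  · obtain ⟨X, hX, Y, hY, hXY⟩ := h13
    exact (eq_of_commutesWithAd_of_lie_ne_zero hM (i := 4) (j := 3) (h X hX) hY
      (lie_mem_gradingSpace_sub htop one_pos three_pos (by norm_num) (.inr (by norm_num)) hX hY)
      hXY).symm

/-- The brackets of `𝔭₂` with `Z` and `𝔭₁` have components in `𝔭₂` and `𝔭₃`. -/
theorem eq_of_commutesWithAd_two
    (h : ∀ V ∈ gradingSpace Z 2, CommutesWithAd M V) : c 0 = c 3 ∧ c 2 = c 4 := by
  obtain ⟨X, hX, Y, hY, hXY⟩ := h13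
  have hR : ⁅X, Y⁆ ∈ gradingSpace Z 2 :=
    lie_mem_gradingSpace_sub htop one_pos three_pos (by norm_num) (.inr (by norm_num)) hX hY
  constructor
  · refine eq_of_commutesWithAd_of_lie_ne_zero hM (i := 0) (j := 3) (h _ hR)
      (self_mem_gradedComponent hneg)
      (lie_mem_gradingSpace_of_zero hneg hR (self_mem_gradedComponent hneg).1) fun h0 => ?_
    have h1 := mem_gradingSpace.1 hR
    rw [← lie_skew, neg_eq_zero] at h0
    rw [h0, lie_zero, eq_comm, neg_eq_zero, smul_eq_zero] at h1
    norm_num at h1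
    exact hXY h1
  · refine eq_of_commutesWithAd_of_killingForm_ne_zero hM (i := 2) (j := 4)
      (hM.killingForm_symm hneg (iSup_gradedComponent_eq_top hneg htop)) (h _ hR) hX hY ?_
    rw [killingForm_lie_left]
    exact (hneg _ hXY).ne

/-- The brackets of `𝔭₃` with `Z` and `𝔭₁` have components in `𝔭₃` and `𝔭₂`. -/
theorem eq_of_commutesWithAd_three
    (h : ∀ V ∈ gradingSpace Z 3, CommutesWithAd M V) : c 0 = c 4 ∧ c 2 = c 3 := by
  obtain ⟨X, hX, Y, hY, hXY⟩ := h13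
  constructor
  · refine eq_of_commutesWithAd_of_lie_ne_zero hM (i := 0) (j := 4) (h _ hY)
      (self_mem_gradedComponent hneg)
      (lie_mem_gradingSpace_of_zero hneg hY (self_mem_gradedComponent hneg).1) fun h0 => ?_
    have h1 := mem_gradingSpace.1 hY
    rw [← lie_skew, neg_eq_zero] at h0
    rw [h0, lie_zero, eq_comm, neg_eq_zero, smul_eq_zero] at h1
    norm_num at h1
    exact hXY (by rw [h1, lie_zero])
  · rw [← lie_skew, neg_ne_zero] at hXY
    exact eq_of_commutesWithAd_of_lie_ne_zero hM (i := 2) (j := 3) (h Y hY) hX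
      (lie_mem_gradingSpace_sub htop three_pos one_pos (by norm_num) (.inl (by norm_num)) hY hX)
      hXY

omit [Module.Finite ℝ 𝔤] [LieAlgebra.IsKilling ℝ 𝔤] htop h13 in
theorem eq_of_commutesWithAd_derived {j : Fin 5} {r : ℝ}
    (hj : gradedComponent Z j = gradingSpace Z r)
    (hact : ∃ W ∈ gradedComponent Z 1, ∃ P ∈ gradingSpace Z r, ⁅W, P⁆ ≠ 0)
    (h : ∀ V ∈ gradingSpace Z r, CommutesWithAd M V) : c 1 = c j := by
  obtain ⟨W, hW, P, hP, hWP⟩ := hact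
  rw [← lie_skew, neg_ne_zero] at hWP
  refine eq_of_commutesWithAd_of_lie_ne_zero hM (h P hP) hW ?_ hWP
  rw [hj]
  exact lie_mem_gradingSpace_of_zero hneg hP (gradedComponent_one_le hneg hW)

variable
  (h12 : ∃ X ∈ gradingSpace Z 1, ∃ Y ∈ gradingSpace Z 2, ⁅X, Y⁆ ∉ gradingSpace Z 3)
  (hact3 : ∃ W ∈ gradedComponent Z 1, ∃ P ∈ gradingSpace Z 3, ⁅W, P⁆ ≠ 0)
  (hc : ∀ i, c i ≠ 0)
include h12 hact3 hc

/-- If `𝔭₁` commutes with `M`, the third case holds. Otherwise `r = 1 / c₂`, and whichever of `𝔭₂`,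
`𝔭₃` has another value of `c` commutes with `M`; the condition `p` expresses that `𝔭₂` does. -/
theorem exists_scalar_iff {p : Prop} (hp : (∀ V ∈ gradingSpace Z 2, CommutesWithAd M V) ↔ p) :
    (∃ r : ℝ, ∀ i, r * c i = 1 ∨ ∀ V ∈ gradedComponent Z i, CommutesWithAd M V) ↔
      (p ∨ (c 0 = c 1 ∧ c 1 = c 4 ∧ c 2 = c 3) ∨ (c 2 = c 3 ∧ c 3 = c 4)) := by
  constructor
  · rintro ⟨r, hr⟩
    rcases hr 2 with h2 | h2
    · rcases hr 3 with h3 | h3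
      · rcases hr 4 with h4 | h4
        · have hr0 : r ≠ 0 := left_ne_zero_of_mul_eq_one h2
          exact .inr (.inr ⟨mul_left_cancel₀ hr0 (h2.trans h3.symm),
            mul_left_cancel₀ hr0 (h3.trans h4.symm)⟩)
        · obtain ⟨e1, e2⟩ := eq_of_commutesWithAd_three hneg htop hM h13 h4
          have e3 := eq_of_commutesWithAd_derived hneg hM (j := 4) rfl hact3 h4
          exact .inr (.inl ⟨e1.trans e3.symm, e3, e2⟩)
      · exact .inl (hp.1 h3)
    · exact .inr (.inr (eq_of_commutesWithAd_one hneg htop hM h13 h12 h2))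
  · intro h
    refine ⟨(c 2)⁻¹, ?_⟩
    have h2 : (c 2)⁻¹ * c 2 = 1 := inv_mul_cancel₀ (hc 2)
    have h0 := fun V hV => commutesWithAd_of_mem_zero hneg htop hM (V := V) hV
    -- the centre and the derived algebra of `𝔨` commute with `M` in any case
    rw [Fin.forall_fin_succ, Fin.forall_fin_succ, Fin.forall_fin_succ, Fin.forall_fin_two]
    refine ⟨.inr fun V hV => h0 V hV.1,
      .inr fun V hV => h0 V (gradedComponent_one_le hneg hV), .inl h2, ?_⟩
    rcases h with h | ⟨e1, e2, e3⟩ | ⟨e1, e2⟩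
    · have h3 := hp.2 h
      exact ⟨.inr h3, .inl ((eq_of_commutesWithAd_two hneg htop hM h13 h3).2 ▸ h2)⟩
    · exact ⟨.inl (e3 ▸ h2), .inr fun V hV => commutesWithAd_of_mem_three hneg htop hM e1 e2 e3 hV⟩
    · exact ⟨.inl (e1 ▸ h2), .inl (e2 ▸ e1 ▸ h2)⟩

/-- The classification when `[𝔨, 𝔨]` acts nontrivially on the second and third summands. -/
theorem exists_scalar_iff_of_nontrivial
    (hact2 : ∃ W ∈ gradedComponent Z 1, ∃ P ∈ gradingSpace Z 2, ⁅W, P⁆ ≠ 0) :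
    (∃ r : ℝ, ∀ i, r * c i = 1 ∨ ∀ V ∈ gradedComponent Z i, CommutesWithAd M V) ↔
      ((c 0 = c 1 ∧ c 1 = c 3 ∧ c 2 = c 4) ∨ (c 0 = c 1 ∧ c 1 = c 4 ∧ c 2 = c 3) ∨
        (c 2 = c 3 ∧ c 3 = c 4)) := by
  refine exists_scalar_iff hneg htop hM h13 h12 hact3 hc ⟨fun h => ?_, ?_⟩
  · obtain ⟨e1, e2⟩ := eq_of_commutesWithAd_two hneg htop hM h13 h
    have e3 := eq_of_commutesWithAd_derived hneg hM (j := 3) rfl hact2 h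
    exact ⟨e1.trans e3.symm, e3, e2⟩
  · rintro ⟨e1, e2, e3⟩ V hV
    exact commutesWithAd_of_mem_two hneg htop hM e1 e2 e3 hV

/-- The classification when `[𝔨, 𝔨]` acts trivially on the second summand. -/
theorem exists_scalar_iff_of_trivial
    (htriv : ∀ W ∈ gradedComponent Z 1, ∀ P ∈ gradingSpace Z 2, ⁅W, P⁆ = 0) :
    (∃ r : ℝ, ∀ i, r * c i = 1 ∨ ∀ V ∈ gradedComponent Z i, CommutesWithAd M V) ↔
      ((c 0 = c 3 ∧ c 2 = c 4) ∨ (c 0 = c 1 ∧ c 1 = c 4 ∧ c 2 = c 3) ∨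
        (c 2 = c 3 ∧ c 3 = c 4)) :=
  exists_scalar_iff hneg htop hM h13 h12 hact3 hc
    ⟨fun h => eq_of_commutesWithAd_two hneg htop hM h13 h,
      fun h _ hV => commutesWithAd_of_mem_two_of_trivial hneg htop hM htriv h.1 h.2 hV⟩

end Classification

end Commutation

/-! ### Coordinates of roots in a base -/

section Coordinates

variable {ι R M N : Type*} [Field R] [AddCommGroup M] [Module R M]
  [AddCommGroup N] [Module R N] {P : RootPairing ι R M N} [P.IsRootSystem] [P.IsCrystallographic]
  {ℓ : ℕ}

/-- The root `i` has the integer coordinates `c` in the base `b`, whose simple roots are numbered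
by `e`. -/
def HasCoords (b : P.Base) (e : b.support ≃ Fin ℓ) (c : Fin ℓ → ℤ) (i : ι) : Prop :=
  ∀ k, b.toWeightBasis.repr (P.root i) (e.symm k) = c k

/-- The reflection in the simple root number `j` on coordinate vectors. -/
def reflectCoords (A : Matrix (Fin ℓ) (Fin ℓ) ℤ) (j : Fin ℓ) (c : Fin ℓ → ℤ) : Fin ℓ → ℤ :=
  fun k => if k = j then c k - ∑ i, c i * A i j else c k

variable {b : P.Base} {e : b.support ≃ Fin ℓ} {A : Matrix (Fin ℓ) (Fin ℓ) ℤ}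

omit [P.IsCrystallographic] in
theorem hasCoords_single (j : Fin ℓ) : HasCoords b e (Pi.single j 1) (e.symm j : ι) := by
  classical
  intro k
  rw [b.toWeightBasis_repr_root, Finsupp.single_apply, Pi.single_apply]
  simp [eq_comm]

omit [P.IsCrystallographic] in
theorem HasCoords.root_eq {c : Fin ℓ → ℤ} {i : ι} (h : HasCoords b e c i) :
    P.root i = ∑ k, (c k : R) • P.root (e.symm k) := by
  have := Fintype.ofEquiv _ e.symm
  conv_lhs => rw [← b.toWeightBasis.sum_repr (P.root i)]
  rw [← e.symm.sum_comp]
  simp [h _]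

theorem HasCoords.pairing_eq (hA : ∀ i j, b.cartanMatrix i j = A (e i) (e j))
    {c : Fin ℓ → ℤ} {i : ι} (h : HasCoords b e c i) (j : Fin ℓ) :
    P.pairing i (e.symm j) = ((∑ k, c k * A k j : ℤ) : R) := by
  have hk : ∀ k, P.pairing (e.symm k) (e.symm j) = (A k j : R) := fun k => by
    have := hA (e.symm k) (e.symm j)
    rw [e.apply_symm_apply, e.apply_symm_apply] at this
    rw [← this]
    exact (b.algebraMap_cartanMatrixIn_apply ℤ _ _).symm
  rw [← P.root_coroot_eq_pairing, h.root_eq, map_sum, LinearMap.sum_apply]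
  push_cast
  refine Finset.sum_congr rfl fun k _ => ?_
  rw [map_smul, LinearMap.smul_apply, P.root_coroot_eq_pairing, hk, smul_eq_mul]

theorem HasCoords.reflect (hA : ∀ i j, b.cartanMatrix i j = A (e i) (e j))
    {c : Fin ℓ → ℤ} {i : ι} (h : HasCoords b e c i) (j : Fin ℓ) :
    HasCoords b e (reflectCoords A j c) (P.reflectionPerm (e.symm j) i) := by
  classical
  intro k
  rw [P.root_reflectionPerm, P.reflection_apply_root, map_sub, map_smul,
    b.toWeightBasis_repr_root, h.pairing_eq hA, Finsupp.sub_apply, Finsupp.smul_apply, h k,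
    Finsupp.single_apply, reflectCoords]
  by_cases hkj : k = j
  · simp [hkj]
  · simp [hkj, Ne.symm hkj]

/-- The simple roots and their images under words in the simple reflections are roots. -/
theorem exists_hasCoords_of_word (hA : ∀ i j, b.cartanMatrix i j = A (e i) (e j))
    (w : List (Fin ℓ)) (j : Fin ℓ) :
    ∃ i, HasCoords b e (w.foldr (reflectCoords A) (Pi.single j 1)) i := by
  induction w with
  | nil => exact ⟨_, hasCoords_single j⟩
  | cons a w ih =>
    obtain ⟨i, hi⟩ := ih
    exact ⟨_, hi.reflect hA a⟩

variable [CharZero R]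

/-- Every root is obtained from the simple roots by simple reflections and sign changes, so a
property of coordinates preserved by these holds for all roots. -/
theorem exists_hasCoords [Finite ι] [P.IsReduced]
    (hA : ∀ i j, b.cartanMatrix i j = A (e i) (e j)) {good : (Fin ℓ → ℤ) → Prop}
    (h1 : ∀ j, good (Pi.single j 1)) (hn : ∀ c, good c → good (-c))
    (hr : ∀ c j, good c → good (reflectCoords A j c)) (i : ι) :
    ∃ c, HasCoords b e c i ∧ good c := by
  refine b.induction_reflect i (p := fun i => ∃ c, HasCoords b e c i ∧ good c) ?_ ?_ ?_
  · rintro i ⟨c, hc, hg⟩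
    refine ⟨-c, fun k => ?_, hn c hg⟩
    rw [P.root_reflectionPerm, P.reflection_apply_self, map_neg, Finsupp.neg_apply, hc k]
    simp
  · intro i hi
    refine ⟨_, ?_, h1 (e ⟨i, hi⟩)⟩
    have := hasCoords_single (b := b) (e := e) (e ⟨i, hi⟩)
    rwa [e.symm_apply_apply] at this
  · rintro i j ⟨c, hc, hg⟩ hj
    refine ⟨_, ?_, hr c (e ⟨j, hj⟩) hg⟩
    have := hc.reflect hA (e ⟨j, hj⟩)
    rwa [e.symm_apply_apply] at this

/-! ### The root lattices of type `E₈` and `G₂` -/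

/-- The normalized quadratic form of the root lattice of type `E₈`. The simple root at the end
of the arm of length one has the number `1`, counting from `0`. -/
def quadE₈ (c : Fin 8 → ℤ) : ℤ :=
  c 0 ^ 2 + c 1 ^ 2 + c 2 ^ 2 + c 3 ^ 2 + c 4 ^ 2 + c 5 ^ 2 + c 6 ^ 2 + c 7 ^ 2 -
    (c 0 * c 2 + c 1 * c 3 + c 2 * c 3 + c 3 * c 4 + c 4 * c 5 + c 5 * c 6 + c 6 * c 7)

theorem quadE₈_reflectCoords (c : Fin 8 → ℤ) (j : Fin 8) :
    quadE₈ (reflectCoords CartanMatrix.E₈ j c) = quadE₈ c := by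
  fin_cases j <;>
    simp [quadE₈, reflectCoords, CartanMatrix.E₈, Fin.sum_univ_eight] <;> ring

/-- The bound on the coefficient comes from completing squares, starting from the ends of the
diagram: the form is at least `c₁² / 16`, and equality would force `c₃ = ± 15/2` for `c₁ = ± 4`. -/
theorem abs_le_three_of_quadE₈ {c : Fin 8 → ℤ} (h : quadE₈ c = 1) : |c 1| ≤ 3 := by
  unfold quadE₈ at h
  have hsq : 60 * (2 * c 0 - c 2) ^ 2 + 20 * (3 * c 2 - 2 * c 3) ^ 2 +
      60 * (2 * c 7 - c 6) ^ 2 + 20 * (3 * c 6 - 2 * c 5) ^ 2 + 10 * (4 * c 5 - 3 * c 4) ^ 2 +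
      6 * (5 * c 4 - 4 * c 3) ^ 2 + (8 * c 3 - 15 * c 1) ^ 2 + 15 * c 1 ^ 2 = 240 := by
    linear_combination 240 * h
  have h1 : (8 * c 3 - 15 * c 1) ^ 2 + 15 * c 1 ^ 2 ≤ 240 := by
    rw [← hsq]
    have := sq_nonneg (2 * c 0 - c 2)
    have := sq_nonneg (3 * c 2 - 2 * c 3)
    have := sq_nonneg (2 * c 7 - c 6)
    have := sq_nonneg (3 * c 6 - 2 * c 5)
    have := sq_nonneg (4 * c 5 - 3 * c 4)
    have := sq_nonneg (5 * c 4 - 4 * c 3)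
    linarith
  have h2 : |c 1| ≤ 4 := by
    rw [abs_le]
    constructor <;> nlinarith [sq_nonneg (8 * c 3 - 15 * c 1)]
  have h3 : |c 1| ≠ 4 := fun h4 => by
    have h5 : c 1 ^ 2 = 16 := by rw [← sq_abs, h4]; norm_num
    have h6 : 8 * c 3 - 15 * c 1 = 0 := by
      rw [← sq_eq_zero_iff]
      nlinarith [sq_nonneg (8 * c 3 - 15 * c 1)]
    rcases abs_eq (by norm_num : (0 : ℤ) ≤ 4) |>.1 h4 with h7 | h7 <;> rw [h7] at h6 <;> omega
  omega

/-- The normalized quadratic form of the root lattice of type `G₂`; its values on short and long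
roots are `1` and `3`. -/
def quadG₂ (c : Fin 2 → ℤ) : ℤ := 3 * c 0 ^ 2 - 3 * c 0 * c 1 + c 1 ^ 2

theorem quadG₂_reflectCoords (c : Fin 2 → ℤ) (j : Fin 2) :
    quadG₂ (reflectCoords CartanMatrix.G₂ j c) = quadG₂ c := by
  fin_cases j <;>
    simp [quadG₂, reflectCoords, CartanMatrix.G₂] <;> ring

theorem abs_le_three_of_quadG₂ {c : Fin 2 → ℤ} (h : quadG₂ c = 1 ∨ quadG₂ c = 3) : |c 1| ≤ 3 := by
  unfold quadG₂ at h
  rw [abs_le]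
  rcases h with h | h <;> constructor <;> nlinarith [sq_nonneg (2 * c 0 - c 1)]

theorem eq_of_quadG₂_of_eq_two {c : Fin 2 → ℤ} (h : quadG₂ c = 1 ∨ quadG₂ c = 3) (h2 : c 1 = 2) :
    c 0 = 1 := by
  unfold quadG₂ at h
  rw [h2] at h
  have h3 : (c 0 - 1) ^ 2 * 3 = 0 ∨ (c 0 - 1) ^ 2 * 3 = 2 := by
    rcases h with h | h
    · exact .inl (by linarith)
    · exact .inr (by linarith)
  rcases h3 with h3 | h3
  · simp at h3
    linarith
  · omega

/-! ### Roots of degree two and three -/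

section PaintedDiagram

variable [Finite ι] [P.IsReduced]

theorem exists_coords_E₈ {e : b.support ≃ Fin 8}
    (hA : ∀ i j, b.cartanMatrix i j = CartanMatrix.E₈ (e i) (e j)) (i : ι) :
    ∃ c, HasCoords b e c i ∧ quadE₈ c = 1 :=
  exists_hasCoords hA (fun j => by fin_cases j <;> simp [quadE₈])
    (fun c h => by simpa [quadE₈] using h) (fun c j h => by rw [quadE₈_reflectCoords, h]) i

theorem exists_coords_G₂ {e : b.support ≃ Fin 2}
    (hA : ∀ i j, b.cartanMatrix i j = CartanMatrix.G₂ (e i) (e j)) (i : ι) :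
    ∃ c, HasCoords b e c i ∧ (quadG₂ c = 1 ∨ quadG₂ c = 3) :=
  exists_hasCoords hA (fun j => by fin_cases j <;> simp [quadG₂])
    (fun c h => by simpa [quadG₂] using h) (fun c j h => by rw [quadG₂_reflectCoords]; exact h) i

/-- The properties of the coefficient of the simple root `i₀` on which the classification rests:
it is at most `3` in absolute value, and there are roots of degrees `2` and `3` from which `i₀` can
be subtracted. -/
structure IsDegreeThree (b : P.Base) (i₀ : b.support) : Prop where
  bound : ∀ i, ∃ d : ℤ, b.toWeightBasis.repr (P.root i) i₀ = d ∧ |d| ≤ 3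
  pairing_two : ∃ i, b.toWeightBasis.repr (P.root i) i₀ = 2 ∧ P.pairing i i₀ = 1
  pairing_three : ∃ i, b.toWeightBasis.repr (P.root i) i₀ = 3 ∧ ∃ d : ℕ, 0 < d ∧
    P.pairing i i₀ = d

/-- Some root of degree `d` pairs nontrivially with a simple root other than `i₀`. -/
def HasRootPairing (b : P.Base) (i₀ : b.support) (d : R) : Prop :=
  ∃ i, b.toWeightBasis.repr (P.root i) i₀ = d ∧ ∃ j : b.support, j ≠ i₀ ∧ P.pairing i j ≠ 0

variable {i₀ : b.support}

theorem isDegreeThree_E₈ {e : b.support ≃ Fin 8}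
    (hA : ∀ i j, b.cartanMatrix i j = CartanMatrix.E₈ (e i) (e j)) (h0 : e i₀ = 1) :
    IsDegreeThree b i₀ ∧ HasRootPairing b i₀ 2 ∧ HasRootPairing b i₀ 3 := by
  have hi : i₀ = e.symm 1 := by rw [← h0, e.symm_apply_apply]
  subst hi
  -- words leading from the simple root `i₀` to roots of degree `2` and `3`
  obtain ⟨i, hi⟩ := exists_hasCoords_of_word hA [1, 3, 4, 5, 2, 3, 4, 0, 2, 3] 1
  obtain ⟨j, hj⟩ := exists_hasCoords_of_word hA
    [1, 3, 4, 5, 6, 7, 2, 3, 4, 5, 6, 1, 3, 4, 5, 2, 3, 4, 0, 2, 3] 1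
  have hci : List.foldr (reflectCoords CartanMatrix.E₈) (Pi.single 1 1)
    [1, 3, 4, 5, 2, 3, 4, 0, 2, 3] = ![1, 2, 2, 3, 2, 1, 0, 0] := by decide +kernel
  have hcj : List.foldr (reflectCoords CartanMatrix.E₈) (Pi.single 1 1)
    [1, 3, 4, 5, 6, 7, 2, 3, 4, 5, 6, 1, 3, 4, 5, 2, 3, 4, 0, 2, 3] =
      ![1, 3, 3, 5, 4, 3, 2, 1] := by decide +kernel
  rw [hci] at hi
  rw [hcj] at hj
  refine ⟨⟨fun k => ?_, ⟨i, ?_, ?_⟩, ⟨j, ?_, 1, one_pos, ?_⟩⟩, ⟨i, ?_, e.symm 6, ?_, ?_⟩,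
    ⟨j, ?_, e.symm 0, ?_, ?_⟩⟩
  · obtain ⟨c, hc, hq⟩ := exists_coords_E₈ hA k
    exact ⟨c 1, hc 1, abs_le_three_of_quadE₈ hq⟩
  · simpa using hi 1
  · rw [hi.pairing_eq hA]
    simp [Fin.sum_univ_eight, CartanMatrix.E₈]
  · simpa using hj 1
  · rw [hj.pairing_eq hA]
    simp [Fin.sum_univ_eight, CartanMatrix.E₈]
  · simpa using hi 1
  · simp
  · rw [hi.pairing_eq hA]
    simp [Fin.sum_univ_eight, CartanMatrix.E₈]
  · simpa using hj 1
  · simp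
  · rw [hj.pairing_eq hA]
    simp [Fin.sum_univ_eight, CartanMatrix.E₈]

theorem isDegreeThree_G₂ {e : b.support ≃ Fin 2}
    (hA : ∀ i j, b.cartanMatrix i j = CartanMatrix.G₂ (e i) (e j)) (h0 : e i₀ = 1) :
    IsDegreeThree b i₀ ∧ HasRootPairing b i₀ 3 ∧
      ∀ i j, b.toWeightBasis.repr (P.root i) i₀ = 2 → b.toWeightBasis.repr (P.root j) i₀ = 2 →
        i = j := by
  have hi : i₀ = e.symm 1 := by rw [← h0, e.symm_apply_apply]
  subst hi
  -- a short root of degree `2` and a long root of degree `3`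
  obtain ⟨i, hi⟩ := exists_hasCoords_of_word hA [1, 0] 1
  obtain ⟨j, hj⟩ := exists_hasCoords_of_word hA [1] 0
  have hci : List.foldr (reflectCoords CartanMatrix.G₂) (Pi.single 1 1) [1, 0] = ![1, 2] := by
    decide +kernel
  have hcj : List.foldr (reflectCoords CartanMatrix.G₂) (Pi.single 0 1) [1] = ![1, 3] := by
    decide +kernel
  rw [hci] at hi
  rw [hcj] at hj
  refine ⟨⟨fun k => ?_, ⟨i, ?_, ?_⟩, ⟨j, ?_, 3, three_pos, ?_⟩⟩, ⟨j, ?_, e.symm 0, ?_, ?_⟩,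
    fun i j hi hj => ?_⟩
  · obtain ⟨c, hc, hq⟩ := exists_coords_G₂ hA k
    exact ⟨c 1, hc 1, abs_le_three_of_quadG₂ hq⟩
  · simpa using hi 1
  · rw [hi.pairing_eq hA]
    simp [CartanMatrix.G₂]
  · simpa using hj 1
  · rw [hj.pairing_eq hA]
    simp [CartanMatrix.G₂]
  · simpa using hj 1
  · simp
  · rw [hj.pairing_eq hA]
    simp [CartanMatrix.G₂]
  · obtain ⟨c, hc, hq⟩ := exists_coords_G₂ hA i
    obtain ⟨c', hc', hq'⟩ := exists_coords_G₂ hA j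
    rw [hc 1] at hi
    rw [hc' 1] at hj
    norm_cast at hi hj
    have hcc : c = c' := by
      ext k
      fin_cases k
      · exact (eq_of_quadG₂_of_eq_two hq hi).trans (eq_of_quadG₂_of_eq_two hq' hj).symm
      · exact hi.trans hj.symm
    exact P.root.injective (by rw [hc.root_eq, hc'.root_eq, hcc])

end PaintedDiagram

end Coordinates

/-! ### Real and imaginary parts in the complexification -/

section Complexification

open Complex (I)
open Module.End (eigenspace mem_eigenspace_iff)

variable {𝔤 : Type*} [LieRing 𝔤] [LieAlgebra ℝ 𝔤]

/-- The real part `a` of `1 ⊗ a + i ⊗ b`. -/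
noncomputable def rePart : ℂ ⊗[ℝ] 𝔤 →ₗ[ℝ] 𝔤 :=
  (TensorProduct.lid ℝ 𝔤).toLinearMap ∘ₗ LinearMap.rTensor 𝔤 Complex.reLm

/-- The imaginary part `b` of `1 ⊗ a + i ⊗ b`. -/
noncomputable def imPart : ℂ ⊗[ℝ] 𝔤 →ₗ[ℝ] 𝔤 :=
  (TensorProduct.lid ℝ 𝔤).toLinearMap ∘ₗ LinearMap.rTensor 𝔤 Complex.imLm

@[simp] theorem rePart_tmul (w : ℂ) (X : 𝔤) : rePart (w ⊗ₜ[ℝ] X) = w.re • X := by simp [rePart]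

@[simp] theorem imPart_tmul (w : ℂ) (X : 𝔤) : imPart (w ⊗ₜ[ℝ] X) = w.im • X := by simp [imPart]

theorem eq_rePart_add_imPart (x : ℂ ⊗[ℝ] 𝔤) : x = 1 ⊗ₜ rePart x + I ⊗ₜ imPart x := by
  induction x with
  | zero => simp
  | tmul w X =>
    rw [rePart_tmul, imPart_tmul, ← TensorProduct.smul_tmul, ← TensorProduct.smul_tmul,
      ← TensorProduct.add_tmul]
    congr 1
    apply Complex.ext <;> simp
  | add x y hx hy =>
    conv_lhs => rw [hx, hy]
    simp only [map_add, TensorProduct.tmul_add]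
    abel

theorem ad_tmul_tmul (w w' : ℂ) (X Y : 𝔤) :
    LieAlgebra.ad ℂ (ℂ ⊗[ℝ] 𝔤) (w ⊗ₜ X) (w' ⊗ₜ Y) = (w * w') ⊗ₜ[ℝ] ⁅X, Y⁆ := rfl

theorem rePart_ad (Z : 𝔤) (x : ℂ ⊗[ℝ] 𝔤) :
    rePart (LieAlgebra.ad ℂ (ℂ ⊗[ℝ] 𝔤) (1 ⊗ₜ Z) x) = ⁅Z, rePart x⁆ := by
  conv_lhs => rw [eq_rePart_add_imPart x, map_add, ad_tmul_tmul, ad_tmul_tmul]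
  simp

theorem imPart_ad (Z : 𝔤) (x : ℂ ⊗[ℝ] 𝔤) :
    imPart (LieAlgebra.ad ℂ (ℂ ⊗[ℝ] 𝔤) (1 ⊗ₜ Z) x) = ⁅Z, imPart x⁆ := by
  conv_lhs => rw [eq_rePart_add_imPart x, map_add, ad_tmul_tmul, ad_tmul_tmul]
  simp

theorem one_tmul_injective : Function.Injective fun X : 𝔤 => (1 : ℂ) ⊗ₜ[ℝ] X := fun X Y h => by
  simpa using congrArg rePart h

/-- The square of the adjoint action of `1 ⊗ Z` on the complexification. -/
noncomputable def adSq (Z : 𝔤) : Module.End ℂ (ℂ ⊗[ℝ] 𝔤) :=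
  LieAlgebra.ad ℂ (ℂ ⊗[ℝ] 𝔤) (1 ⊗ₜ Z) ∘ₗ LieAlgebra.ad ℂ (ℂ ⊗[ℝ] 𝔤) (1 ⊗ₜ Z)

theorem adSq_apply (Z : 𝔤) (x : ℂ ⊗[ℝ] 𝔤) : adSq Z x =
    LieAlgebra.ad ℂ (ℂ ⊗[ℝ] 𝔤) (1 ⊗ₜ Z) (LieAlgebra.ad ℂ (ℂ ⊗[ℝ] 𝔤) (1 ⊗ₜ Z) x) := rfl

theorem one_tmul_mem_eigenspace_iff {Z X : 𝔤} {r : ℝ} :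
    (1 : ℂ) ⊗ₜ[ℝ] X ∈ eigenspace (adSq Z) (-(r : ℂ) ^ 2) ↔ X ∈ gradingSpace Z r := by
  rw [mem_eigenspace_iff, mem_gradingSpace, adSq_apply, ad_tmul_tmul, ad_tmul_tmul]
  have : (-(r : ℂ) ^ 2) • (1 : ℂ) ⊗ₜ[ℝ] X = (1 : ℂ) ⊗ₜ[ℝ] (-(r ^ 2 • X)) := by
    rw [TensorProduct.smul_tmul', ← neg_smul, ← TensorProduct.smul_tmul]
    congr 1
    apply Complex.ext <;> simp [pow_two]
  rw [this, one_mul, one_mul]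
  exact one_tmul_injective.eq_iff

theorem real_smul_eq (r : ℝ) (x : ℂ ⊗[ℝ] 𝔤) : (r : ℂ) • x = r • x := by
  rw [← Complex.coe_algebraMap, algebraMap_smul]

theorem rePart_mem {Z : 𝔤} {x : ℂ ⊗[ℝ] 𝔤} {r : ℝ} (hx : x ∈ eigenspace (adSq Z) (-(r : ℂ) ^ 2)) :
    rePart x ∈ gradingSpace Z r := by
  rw [mem_eigenspace_iff, adSq_apply, ← Complex.ofReal_pow, ← Complex.ofReal_neg,
    real_smul_eq] at hx
  rw [mem_gradingSpace, ← rePart_ad, ← rePart_ad, hx, map_smul, neg_smul]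

theorem imPart_mem {Z : 𝔤} {x : ℂ ⊗[ℝ] 𝔤} {r : ℝ} (hx : x ∈ eigenspace (adSq Z) (-(r : ℂ) ^ 2)) :
    imPart x ∈ gradingSpace Z r := by
  rw [mem_eigenspace_iff, adSq_apply, ← Complex.ofReal_pow, ← Complex.ofReal_neg,
    real_smul_eq] at hx
  rw [mem_gradingSpace, ← imPart_ad, ← imPart_ad, hx, map_smul, neg_smul]

/-- The eigenspaces of the complexified operator are the complexifications of the real ones. -/
theorem eigenspace_eq_baseChange (Z : 𝔤) (r : ℝ) :
    eigenspace (adSq Z) (-(r : ℂ) ^ 2) = (gradingSpace Z r).baseChange ℂ := by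
  apply le_antisymm
  · intro x hx
    rw [eq_rePart_add_imPart x]
    exact Submodule.add_mem _ (Submodule.tmul_mem_baseChange_of_mem _ (rePart_mem hx))
      (Submodule.tmul_mem_baseChange_of_mem _ (imPart_mem hx))
  · rw [Submodule.baseChange_eq_span]
    refine Submodule.span_le.2 ?_
    rintro _ ⟨X, hX, rfl⟩
    exact one_tmul_mem_eigenspace_iff.2 hX

theorem re_im_mem_of_mem_baseChange {p : Submodule ℝ 𝔤} {x : ℂ ⊗[ℝ] 𝔤} (hx : x ∈ p.baseChange ℂ) :
    rePart x ∈ p ∧ imPart x ∈ p := by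
  rw [Submodule.baseChange_eq_span] at hx
  induction hx using Submodule.span_induction with
  | mem x hx =>
    obtain ⟨X, hX, rfl⟩ := hx
    simpa using hX
  | zero => simp
  | add x y _ _ hx hy =>
    rw [map_add, map_add]
    exact ⟨p.add_mem hx.1 hy.1, p.add_mem hx.2 hy.2⟩
  | smul w x _ hx =>
    rw [eq_rePart_add_imPart x]
    simp only [smul_add, TensorProduct.smul_tmul', map_add, rePart_tmul, imPart_tmul]
    exact ⟨p.add_mem (p.smul_mem _ hx.1) (p.smul_mem _ hx.2),
      p.add_mem (p.smul_mem _ hx.1) (p.smul_mem _ hx.2)⟩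

theorem ad_mem_baseChange {p q s : Submodule ℝ 𝔤} (h : ∀ X ∈ p, ∀ Y ∈ q, ⁅X, Y⁆ ∈ s)
    {x y : ℂ ⊗[ℝ] 𝔤} (hx : x ∈ p.baseChange ℂ) (hy : y ∈ q.baseChange ℂ) :
    LieAlgebra.ad ℂ (ℂ ⊗[ℝ] 𝔤) x y ∈ s.baseChange ℂ := by
  rw [Submodule.baseChange_eq_span] at hx hy
  induction hx, hy using Submodule.span_induction₂ with
  | mem_mem x y hx hy =>
    obtain ⟨X, hX, rfl⟩ := hx
    obtain ⟨Y, hY, rfl⟩ := hy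
    rw [TensorProduct.mk_apply, TensorProduct.mk_apply, ad_tmul_tmul]
    exact Submodule.tmul_mem_baseChange_of_mem _ (h X hX Y hY)
  | zero_left y hy => simp
  | zero_right x hx => simp
  | add_left x y z _ _ _ h1 h2 =>
    rw [map_add, LinearMap.add_apply]
    exact Submodule.add_mem _ h1 h2
  | add_right x y z _ _ _ h1 h2 =>
    rw [map_add]
    exact Submodule.add_mem _ h1 h2
  | smul_left r x y _ _ h1 =>
    rw [map_smul, LinearMap.smul_apply]
    exact Submodule.smul_mem _ _ h1
  | smul_right r x y _ _ h1 =>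
    rw [map_smul]
    exact Submodule.smul_mem _ _ h1

end Complexification

/-! ### Eigenspaces and root spaces -/

section RootSpaces

open Module.End (eigenspace mem_eigenspace_iff)
open LieAlgebra LieAlgebra.IsKilling

variable {L : Type*} [LieRing L] [LieAlgebra ℂ L] [Module.Finite ℂ L] [IsKilling ℂ L]
  {H : LieSubalgebra ℂ L} [H.IsCartanSubalgebra]

/-- A family of subspaces of the eigenspaces that spans everything consists of the full
eigenspaces. -/
theorem eq_eigenspace_of_le {V : Type*} [AddCommGroup V] [Module ℂ V] (A : Module.End ℂ V)
    (W : ℂ → Submodule ℂ V) (hW : ∀ μ, W μ ≤ eigenspace A μ) (htop : ⨆ μ, W μ = ⊤) (μ : ℂ) :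
    W μ = eigenspace A μ := by
  refine le_antisymm (hW μ) ?_
  have hd : Disjoint (eigenspace A μ) (⨆ (ν) (_ : ν ≠ μ), W ν) :=
    (A.eigenspaces_iSupIndep μ).mono_right (iSup₂_mono fun ν _ => hW ν)
  calc eigenspace A μ = (W μ ⊔ ⨆ (ν) (_ : ν ≠ μ), W ν) ⊓ eigenspace A μ := by
        rw [← iSup_split_single, htop, top_inf_eq]
    _ = W μ ⊔ (⨆ (ν) (_ : ν ≠ μ), W ν) ⊓ eigenspace A μ := sup_inf_assoc_of_le _ (hW μ)
    _ ≤ W μ := by rw [inf_comm, hd.eq_bot, sup_bot_eq]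

omit [IsKilling ℂ L] in
theorem sup_iSup_rootSpace_eq_top :
    H.toSubmodule ⊔ ⨆ α : H.root, (rootSpace H (α : H → ℂ)).toSubmodule = ⊤ := by
  have h := LieModule.iSup_genWeightSpace_eq_top' ℂ H L
  rw [← LieSubmodule.toSubmodule_inj, LieSubmodule.iSup_toSubmodule,
    LieSubmodule.top_toSubmodule] at h
  rw [eq_top_iff, ← h, iSup_le_iff]
  intro α
  by_cases hα : α.IsZero
  · refine le_sup_of_le_left ?_
    have : (α : H → ℂ) = 0 := hα
    rw [this]
    change (rootSpace H 0).toSubmodule ≤ _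
    rw [rootSpace_zero_eq]
    exact le_rfl
  · exact le_sup_of_le_right (le_iSup (fun α : H.root => (rootSpace H (α : H → ℂ)).toSubmodule)
      ⟨α, by simpa [LieSubalgebra.root] using hα⟩)

omit [IsKilling ℂ L] in
/-- The eigenspaces of an operator that vanishes on `H` and acts as a scalar on every root
space. -/
theorem eigenspace_eq_iSup_rootSpace (A : Module.End ℂ L) (χ : H.root → ℂ)
    (hH : ∀ h ∈ H, A h = 0)
    (hα : ∀ α : H.root, ∀ v ∈ rootSpace H (α : H → ℂ), A v = χ α • v) (μ : ℂ) :
    (⨆ _ : μ = 0, H.toSubmodule) ⊔ (⨆ α : H.root, ⨆ _ : χ α = μ,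
      (rootSpace H (α : H → ℂ)).toSubmodule) = eigenspace A μ := by
  refine eq_eigenspace_of_le A (fun μ => (⨆ _ : μ = 0, H.toSubmodule) ⊔ (⨆ α : H.root,
    ⨆ _ : χ α = μ, (rootSpace H (α : H → ℂ)).toSubmodule)) (fun μ => ?_) ?_ μ
  · refine sup_le (iSup_le ?_) (iSup₂_le ?_)
    · rintro rfl h hh
      rw [mem_eigenspace_iff, hH h hh, zero_smul]
    · rintro α rfl v hv
      exact mem_eigenspace_iff.2 (hα α v hv)
  · rw [eq_top_iff, ← sup_iSup_rootSpace_eq_top (H := H)]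
    refine sup_le ?_ (iSup_le fun α => ?_)
    · exact le_iSup_of_le 0 (le_sup_of_le_left (le_iSup_of_le rfl le_rfl))
    · exact le_iSup_of_le (χ α) (le_sup_of_le_right (le_iSup₂_of_le α rfl le_rfl))

/-- If the root `γ` pairs positively with the coroot of `α`, a lowering operator for `α` does not
kill the root space of `γ`. -/
theorem exists_lie_ne_zero_of_pairing_pos (α γ : H.root) {d : ℕ} (hd : 0 < d)
    (h : (rootSystem H).pairing γ α = d) :
    ∃ f ∈ rootSpace H (-(α : H → ℂ)), ∃ v ∈ rootSpace H (γ : H → ℂ), ⁅f, v⁆ ≠ 0 := by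
  have hα : (α : LieModule.Weight ℂ H L).IsNonZero := LieSubalgebra.isNonZero_coe_root α
  obtain ⟨x, e, f, t, he, hf⟩ := exists_isSl2Triple_of_weight_isNonZero hα
  have hx := t.h_eq_coroot hα he hf
  obtain ⟨v, hv, hv0⟩ := (γ : LieModule.Weight ℂ H L).exists_ne_zero
  refine ⟨f, hf, v, hv, fun hfv => ?_⟩
  have hxv : ⁅x, v⁆ = (d : ℂ) • v := by
    rw [hx, ← h]
    exact lie_eq_smul_of_mem_rootSpace hv _
  have P : t.symm.HasPrimitiveVectorWith v (-(d : ℂ)) :=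
    ⟨hv0, by rw [neg_lie, hxv, neg_smul], hfv⟩
  obtain ⟨k, hk⟩ := P.exists_nat
  have : ((d + k : ℕ) : ℂ) = 0 := by
    push_cast
    rw [← hk]
    ring
  rw [Nat.cast_eq_zero] at this
  omega

end RootSpaces

/-! ### The grading element of a simple root -/

section GradingElement

open Complex (I)
open Module.End (eigenspace mem_eigenspace_iff)
open LieAlgebra

variable {𝔤 : Type*} [LieRing 𝔤] [LieAlgebra ℝ 𝔤]

/-- As `ad X` is skew for the definite Killing form, its eigenvalues are imaginary. -/
theorem re_eq_zero_of_ad_eq_smul (hneg : ∀ x : 𝔤, x ≠ 0 → killingForm ℝ 𝔤 x x < 0) {X : 𝔤}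
    {v : ℂ ⊗[ℝ] 𝔤} (hv : v ≠ 0) {μ : ℂ} (h : ad ℂ (ℂ ⊗[ℝ] 𝔤) (1 ⊗ₜ X) v = μ • v) : μ.re = 0 := by
  have hre : ⁅X, rePart v⁆ = μ.re • rePart v - μ.im • imPart v := by
    rw [← rePart_ad, h]
    conv_lhs => rw [eq_rePart_add_imPart v]
    simp [TensorProduct.smul_tmul', sub_eq_add_neg]
  have him : ⁅X, imPart v⁆ = μ.im • rePart v + μ.re • imPart v := by
    rw [← imPart_ad, h]
    conv_lhs => rw [eq_rePart_add_imPart v]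
    simp [TensorProduct.smul_tmul']
  have hskew : ∀ Y : 𝔤, killingForm ℝ 𝔤 ⁅X, Y⁆ Y = 0 := fun Y => by
    have h1 := killingForm_lie_skew X Y Y
    rw [killingForm_symm Y] at h1
    linarith
  have e1 := hskew (rePart v)
  have e2 := hskew (imPart v)
  rw [hre] at e1
  rw [him] at e2
  simp only [map_sub, map_add, map_smul, LinearMap.sub_apply, LinearMap.add_apply,
    LinearMap.smul_apply, smul_eq_mul] at e1 e2
  rw [killingForm_symm (imPart v) (rePart v)] at e1
  have hle : ∀ Y : 𝔤, killingForm ℝ 𝔤 Y Y ≤ 0 := fun Y => by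
    rcases eq_or_ne Y 0 with rfl | h0
    · simp
    · exact (hneg Y h0).le
  have hsum : μ.re * (killingForm ℝ 𝔤 (rePart v) (rePart v) +
      killingForm ℝ 𝔤 (imPart v) (imPart v)) = 0 := by linarith
  refine (mul_eq_zero.1 hsum).resolve_right (ne_of_lt ?_)
  by_cases h0 : rePart v = 0
  · have h1 : imPart v ≠ 0 := fun h1 => hv (by rw [eq_rePart_add_imPart v, h0, h1]; simp)
    linarith [hneg _ h1, hle (rePart v)]
  · linarith [hneg _ h0, hle (imPart v)]

variable [Module.Finite ℝ 𝔤] [IsKilling ℝ 𝔤] {H : LieSubalgebra ℂ (ℂ ⊗[ℝ] 𝔤)}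
  [H.IsCartanSubalgebra] {b : (IsKilling.rootSystem H).Base} {i₀ : b.support}

/-- The element `Z` of the real Lie algebra acts on `H` by `0` and on each root space by `-i` times
the coefficient of `i₀` in the root. -/
structure IsGradingElement (b : (IsKilling.rootSystem H).Base) (i₀ : b.support) (Z : 𝔤) : Prop where
  ad_cartan : ∀ h ∈ H, ad ℂ (ℂ ⊗[ℝ] 𝔤) (1 ⊗ₜ Z) h = 0
  ad_root : ∀ α : H.root, ∀ v ∈ rootSpace H (α : H → ℂ),
    ad ℂ (ℂ ⊗[ℝ] 𝔤) (1 ⊗ₜ Z) v = (-I * coeff b i₀ α) • v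

/-- The fundamental coweight of `i₀` is `i` times an element of `𝔱`, because roots take imaginary
values on `𝔱`. -/
theorem exists_isGradingElement (hneg : ∀ x : 𝔤, x ≠ 0 → killingForm ℝ 𝔤 x x < 0)
    {𝔱 : LieSubalgebra ℝ 𝔤} (hH : H.toSubmodule = 𝔱.toSubmodule.baseChange ℂ)
    (hint : ∀ α, ∃ d : ℤ, coeff b i₀ α = d) : ∃ Z : 𝔤, IsGradingElement b i₀ Z := by
  let ω : H := (Module.evalEquiv ℂ H).symm (b.toWeightBasis.coord i₀)
  have hω : ∀ α : H.root, (α : LieModule.Weight ℂ H (ℂ ⊗[ℝ] 𝔤)) ω = coeff b i₀ α := fun α =>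
    Module.apply_evalEquiv_symm_apply _ _ ((IsKilling.rootSystem H).root α) _
  have hHmem : ∀ X ∈ 𝔱, (1 : ℂ) ⊗ₜ[ℝ] X ∈ H := fun X hX => by
    rw [← LieSubalgebra.mem_toSubmodule, hH]
    exact Submodule.tmul_mem_baseChange_of_mem _ hX
  have hω𝔱 := re_im_mem_of_mem_baseChange (p := 𝔱.toSubmodule) (x := ω) (hH ▸ ω.2)
  let h₁ : H := ⟨1 ⊗ₜ rePart (ω : ℂ ⊗[ℝ] 𝔤), hHmem _ hω𝔱.1⟩
  let h₂ : H := ⟨1 ⊗ₜ imPart (ω : ℂ ⊗[ℝ] 𝔤), hHmem _ hω𝔱.2⟩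
  have hωh : ω = h₁ + I • h₂ := by
    apply Subtype.ext
    rw [eq_rePart_add_imPart (ω : ℂ ⊗[ℝ] 𝔤)]
    simp [h₁, h₂, TensorProduct.smul_tmul']
  refine ⟨imPart (ω : ℂ ⊗[ℝ] 𝔤), fun h hh => ?_, fun α v hv => ?_⟩
  · have h0 : ⁅h₂, (⟨h, hh⟩ : H)⁆ = 0 := trivial_lie_zero _ _ _ _
    exact congrArg Subtype.val h0
  · have him : ∀ k : H, ∀ X : 𝔤, (k : ℂ ⊗[ℝ] 𝔤) = 1 ⊗ₜ X →
        ((α : LieModule.Weight ℂ H (ℂ ⊗[ℝ] 𝔤)) k).re = 0 := fun k X hk => by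
      obtain ⟨w, hw, hw0⟩ := (α : LieModule.Weight ℂ H (ℂ ⊗[ℝ] 𝔤)).exists_ne_zero
      refine re_eq_zero_of_ad_eq_smul hneg hw0 (X := X) ?_
      rw [← hk]
      exact IsKilling.lie_eq_smul_of_mem_rootSpace hw k
    obtain ⟨d, hd⟩ := hint α
    have h1 : (α : LieModule.Weight ℂ H (ℂ ⊗[ℝ] 𝔤)) ω =
        (α : LieModule.Weight ℂ H (ℂ ⊗[ℝ] 𝔤)) h₁ +
          I * (α : LieModule.Weight ℂ H (ℂ ⊗[ℝ] 𝔤)) h₂ := by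
      change LieModule.Weight.toLinear ℂ H (ℂ ⊗[ℝ] 𝔤) α ω = _
      rw [hωh, map_add, map_smul]
      rfl
    -- `α ω` is real, and `α` is imaginary on `h₁` and `h₂`, so `α h₁ = 0`
    have h2 : (α : LieModule.Weight ℂ H (ℂ ⊗[ℝ] 𝔤)) h₂ = -I * coeff b i₀ α := by
      rw [hω, hd] at h1
      have e1 := him h₁ _ rfl
      have e2 := him h₂ _ rfl
      have e3 := congrArg Complex.re h1
      have e4 := congrArg Complex.im h1
      simp [e1] at e3
      rw [hd]
      apply Complex.ext
      · simp [e2]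
      · simp [e3]
    have h3 := IsKilling.lie_eq_smul_of_mem_rootSpace hv h₂
    rw [← h2]
    exact h3

variable {Z : 𝔤} (hZ : IsGradingElement b i₀ Z)
include hZ

theorem IsGradingElement.adSq_root (α : H.root) {v : ℂ ⊗[ℝ] 𝔤} (hv : v ∈ rootSpace H (α : H → ℂ)) :
    adSq Z v = (-coeff b i₀ α ^ 2) • v := by
  rw [adSq_apply, hZ.ad_root α v hv, map_smul, hZ.ad_root α v hv, smul_smul]
  congr 1
  linear_combination coeff b i₀ α ^ 2 * Complex.I_sq

theorem IsGradingElement.eigenspace_adSq (μ : ℂ) :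
    (⨆ _ : μ = 0, H.toSubmodule) ⊔ (⨆ α : H.root, ⨆ _ : -coeff b i₀ α ^ 2 = μ,
      (rootSpace H (α : H → ℂ)).toSubmodule) = eigenspace (adSq Z) μ :=
  eigenspace_eq_iSup_rootSpace _ _
    (fun h hh => by rw [adSq_apply, hZ.ad_cartan h hh, map_zero])
    (fun α v hv => hZ.adSq_root α hv) μ

theorem IsGradingElement.isotropy_eq : isotropy b i₀ = gradingSpace Z 0 := by
  ext X
  rw [← one_tmul_mem_eigenspace_iff, ← hZ.eigenspace_adSq]
  change (1 : ℂ) ⊗ₜ[ℝ] X ∈ H.toSubmodule ⊔ ⨆ α : H.root, ⨆ _ : coeff b i₀ α = 0,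
    (rootSpace H (α : H → ℂ)).toSubmodule ↔ _
  simp

theorem IsGradingElement.isotropySummand_eq {j : ℕ} (hj : j ≠ 0) :
    isotropySummand b i₀ j = gradingSpace Z j := by
  ext X
  rw [← one_tmul_mem_eigenspace_iff, ← hZ.eigenspace_adSq]
  have hj' : -((j : ℝ) : ℂ) ^ 2 ≠ 0 := by simpa using hj
  change (1 : ℂ) ⊗ₜ[ℝ] X ∈ (⨆ α : H.root, ⨆ _ : coeff b i₀ α = j ∨ coeff b i₀ α = -j,
    (rootSpace H (α : H → ℂ)).toSubmodule) ↔ _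
  simp [hj, sq_eq_sq_iff_eq_or_eq_neg]

/-- The summands attached to the painted diagram are the graded components of `Z`. -/
theorem IsGradingElement.component_eq : component b i₀ = gradedComponent Z := by
  rw [component, gradedComponent, isotropyCentre, isotropyDerived, hZ.isotropy_eq,
    hZ.isotropySummand_eq one_ne_zero, hZ.isotropySummand_eq two_ne_zero,
    hZ.isotropySummand_eq three_ne_zero]
  simp

theorem IsGradingElement.mem_baseChange (α : H.root) {r : ℝ}
    (hr : coeff b i₀ α = r ∨ coeff b i₀ α = -r) {v : ℂ ⊗[ℝ] 𝔤} (hv : v ∈ rootSpace H (α : H → ℂ)) :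
    v ∈ (gradingSpace Z r).baseChange ℂ := by
  rw [← eigenspace_eq_baseChange, mem_eigenspace_iff, hZ.adSq_root α hv,
    sq_eq_sq_iff_eq_or_eq_neg.2 hr]

theorem IsGradingElement.sup_gradingSpace_eq_top
    (hbound : ∀ α, ∃ d : ℤ, coeff b i₀ α = d ∧ |d| ≤ 3) :
    gradingSpace Z 0 ⊔ gradingSpace Z 1 ⊔ gradingSpace Z 2 ⊔ gradingSpace Z 3 = ⊤ := by
  set T := gradingSpace Z 0 ⊔ gradingSpace Z 1 ⊔ gradingSpace Z 2 ⊔ gradingSpace Z 3 with hT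
  have h0 : gradingSpace Z 0 ≤ T := le_sup_left.trans (le_sup_left.trans le_sup_left)
  have h1 : gradingSpace Z 1 ≤ T := le_sup_right.trans (le_sup_left.trans le_sup_left)
  have h2 : gradingSpace Z 2 ≤ T := le_sup_right.trans le_sup_left
  have h3 : gradingSpace Z 3 ≤ T := le_sup_right
  have hmono : ∀ {p q : Submodule ℝ 𝔤}, p ≤ q → p.baseChange ℂ ≤ q.baseChange ℂ := fun {p q} h => by
    rw [Submodule.baseChange_eq_span, Submodule.baseChange_eq_span]
    exact Submodule.span_mono (Submodule.map_mono h)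
  have hC : T.baseChange ℂ = ⊤ := by
    rw [eq_top_iff, ← sup_iSup_rootSpace_eq_top (H := H)]
    refine sup_le (fun h hh => hmono h0 ?_) (iSup_le fun α v hv => ?_)
    · rw [← eigenspace_eq_baseChange, mem_eigenspace_iff, adSq_apply, hZ.ad_cartan h hh]
      simp
    · obtain ⟨d, hd, hd3⟩ := hbound α
      have hcases : (d = 0 ∨ d = -0) ∨ (d = 1 ∨ d = -1) ∨ (d = 2 ∨ d = -2) ∨ (d = 3 ∨ d = -3) := by
        rw [abs_le] at hd3
        omega
      have hm : ∀ n : ℕ, (d = n ∨ d = -n) → v ∈ (gradingSpace Z (n : ℝ)).baseChange ℂ := fun n hn =>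
        hZ.mem_baseChange α (by
          rw [hd]
          rcases hn with rfl | rfl
          · left; simp
          · right; simp) hv
      rcases hcases with h | h | h | h
      · exact hmono h0 (by simpa using hm 0 (by simpa using h))
      · exact hmono h1 (by simpa using hm 1 (by simpa using h))
      · exact hmono h2 (by simpa using hm 2 (by simpa using h))
      · exact hmono h3 (by simpa using hm 3 (by simpa using h))
  rw [eq_top_iff]
  intro X _
  have hX : (1 : ℂ) ⊗ₜ[ℝ] X ∈ T.baseChange ℂ := hC ▸ Submodule.mem_top
  simpa using (re_im_mem_of_mem_baseChange hX).1

end GradingElement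

/-! ### Nonzero brackets from pairings of roots -/

section Transfer

open Complex (I)
open Module.End (eigenspace mem_eigenspace_iff)
open LieAlgebra

variable {𝔤 : Type*} [LieRing 𝔤] [LieAlgebra ℝ 𝔤] [Module.Finite ℝ 𝔤] [IsKilling ℝ 𝔤]
  {H : LieSubalgebra ℂ (ℂ ⊗[ℝ] 𝔤)} [H.IsCartanSubalgebra]
  {b : (IsKilling.rootSystem H).Base} {i₀ : b.support} {Z : 𝔤}

theorem exists_root_eq_neg (b : (IsKilling.rootSystem H).Base) (i₀ : b.support) (α : H.root) :
    ∃ β : H.root, (β : H → ℂ) = -(α : H → ℂ) ∧ coeff b i₀ β = -coeff b i₀ α := by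
  have hβ : (IsKilling.rootSystem H).root ((IsKilling.rootSystem H).reflectionPerm α α) =
      -(IsKilling.rootSystem H).root α := by
    rw [RootPairing.root_reflectionPerm, RootPairing.reflection_apply_self]
  refine ⟨(IsKilling.rootSystem H).reflectionPerm α α, ?_, ?_⟩
  · funext x
    exact LinearMap.congr_fun hβ x
  · rw [coeff, hβ, map_neg, Finsupp.neg_apply, coeff]

theorem coeff_self (b : (IsKilling.rootSystem H).Base) (i₀ : b.support) : coeff b i₀ i₀ = 1 := by
  rw [coeff, b.toWeightBasis_repr_root, Finsupp.single_eq_same]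

theorem coeff_of_ne {j : b.support} (h : j ≠ i₀) : coeff b i₀ j = 0 := by
  rw [coeff, b.toWeightBasis_repr_root, Finsupp.single_eq_of_ne h.symm]

omit [Module.Finite ℝ 𝔤] [IsKilling ℝ 𝔤] in
theorem ad_leibniz (x y z : ℂ ⊗[ℝ] 𝔤) : ad ℂ (ℂ ⊗[ℝ] 𝔤) x (ad ℂ (ℂ ⊗[ℝ] 𝔤) y z) =
    ad ℂ (ℂ ⊗[ℝ] 𝔤) (ad ℂ (ℂ ⊗[ℝ] 𝔤) x y) z + ad ℂ (ℂ ⊗[ℝ] 𝔤) y (ad ℂ (ℂ ⊗[ℝ] 𝔤) x z) :=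
  leibniz_lie x y z

variable (hZ : IsGradingElement b i₀ Z)
include hZ

/-- A lowering operator for the simple root `i₀` has degree `-1`. -/
theorem IsGradingElement.exists_lowering {d : ℕ} (hd : 0 < d) (γ : H.root)
    (h : (IsKilling.rootSystem H).pairing γ i₀ = d) :
    ∃ f ∈ (gradingSpace Z 1).baseChange ℂ, ∃ v ∈ rootSpace H (γ : H → ℂ),
      ad ℂ (ℂ ⊗[ℝ] 𝔤) (1 ⊗ₜ Z) f = I • f ∧ ad ℂ (ℂ ⊗[ℝ] 𝔤) f v ≠ 0 := by
  obtain ⟨f, hf, v, hv, hfv⟩ := exists_lie_ne_zero_of_pairing_pos (i₀ : H.root) γ hd h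
  obtain ⟨β, hβ, hcβ⟩ := exists_root_eq_neg b i₀ i₀
  rw [coeff_self] at hcβ
  rw [← hβ] at hf
  refine ⟨f, hZ.mem_baseChange β (.inr (by simpa using hcβ)) hf, v, hv, ?_, hfv⟩
  rw [hZ.ad_root β f hf, hcβ]
  simp

theorem IsGradingElement.exists_lie_one_three (hb : IsDegreeThree b i₀) :
    ∃ X ∈ gradingSpace Z 1, ∃ Y ∈ gradingSpace Z 3, ⁅X, Y⁆ ≠ 0 := by
  obtain ⟨γ, hγ, d, hd, hp⟩ := hb.pairing_three
  obtain ⟨f, hf, v, hv, -, hfv⟩ := hZ.exists_lowering hd γ hp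
  by_contra! h
  refine hfv ?_
  have := ad_mem_baseChange (s := ⊥) (fun X hX Y hY => h X hX Y hY) hf
    (hZ.mem_baseChange γ (r := 3) (.inl (by rw [coeff, hγ]; norm_num)) hv)
  simpa using this

/-- The bracket of a root vector of degree `2` with a lowering operator for `i₀` has degree `1`. -/
theorem IsGradingElement.exists_lie_one_two (hb : IsDegreeThree b i₀) :
    ∃ X ∈ gradingSpace Z 1, ∃ Y ∈ gradingSpace Z 2, ⁅X, Y⁆ ∉ gradingSpace Z 3 := by
  obtain ⟨γ, hγ, hp⟩ := hb.pairing_two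
  obtain ⟨f, hf, v, hv, hZf, hfv⟩ := hZ.exists_lowering one_pos γ (by simpa using hp)
  by_contra! h
  refine hfv ?_
  have h3 := ad_mem_baseChange (fun X hX Y hY => h X hX Y hY) hf
    (hZ.mem_baseChange γ (r := 2) (.inl (by rw [coeff, hγ]; norm_num)) hv)
  have h1 : ad ℂ (ℂ ⊗[ℝ] 𝔤) (1 ⊗ₜ Z) (ad ℂ (ℂ ⊗[ℝ] 𝔤) f v) = (-I) • ad ℂ (ℂ ⊗[ℝ] 𝔤) f v := by
    rw [ad_leibniz, hZf, hZ.ad_root γ v hv, coeff, hγ, map_smul, map_smul, LinearMap.smul_apply,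
      ← add_smul]
    congr 1
    ring
  rw [← eigenspace_eq_baseChange, mem_eigenspace_iff, adSq_apply, h1, map_smul, h1, smul_smul,
    ← sub_eq_zero, ← sub_smul] at h3
  refine (smul_eq_zero.1 h3).resolve_left ?_
  have : -I * -I = -1 := by rw [neg_mul_neg, Complex.I_mul_I]
  rw [this]
  norm_num

/-- The coroot of a simple root other than `i₀` is a commutator of elements of degree `0`. -/
theorem IsGradingElement.exists_lie_derived {r : ℝ} (hr : HasRootPairing b i₀ (r : ℂ)) :
    ∃ W ∈ gradedComponent Z 1, ∃ P ∈ gradingSpace Z r, ⁅W, P⁆ ≠ 0 := by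
  obtain ⟨γ, hγ, j, hj, hp⟩ := hr
  by_contra! h
  have hα : ((j : H.root) : LieModule.Weight ℂ H (ℂ ⊗[ℝ] 𝔤)).IsNonZero :=
    LieSubalgebra.isNonZero_coe_root _
  obtain ⟨x, e, f, t, he, hf⟩ := IsKilling.exists_isSl2Triple_of_weight_isNonZero hα
  have hx := t.h_eq_coroot hα he hf
  obtain ⟨v, hv, hv0⟩ := (γ : LieModule.Weight ℂ H (ℂ ⊗[ℝ] 𝔤)).exists_ne_zero
  obtain ⟨β, hβ, hcβ⟩ := exists_root_eq_neg b i₀ j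
  rw [coeff_of_ne hj, neg_zero] at hcβ
  replace hf : f ∈ rootSpace H (-((j : H.root) : H → ℂ)) := hf
  rw [← hβ] at hf
  have he0 := hZ.mem_baseChange j (r := 0) (.inl (by simpa using coeff_of_ne hj)) he
  have hf0 := hZ.mem_baseChange β (r := 0) (.inl (by simpa using hcβ)) hf
  have hx1 : x ∈ (gradedComponent Z 1).baseChange ℂ := by
    rw [← t.lie_e_f]
    exact ad_mem_baseChange (fun X hX Y hY => lie_mem_gradedComponent_one hX hY) he0 hf0
  have hxv := ad_mem_baseChange (s := ⊥) (fun X hX Y hY => h X hX Y hY) hx1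
    (hZ.mem_baseChange γ (.inl hγ) hv)
  have hxv' : ad ℂ (ℂ ⊗[ℝ] 𝔤) x v = (IsKilling.rootSystem H).pairing γ j • v := by
    rw [hx]
    exact IsKilling.lie_eq_smul_of_mem_rootSpace hv _
  rw [hxv'] at hxv
  exact smul_ne_zero hp hv0 (by simpa using hxv)

/-- If there is one root of degree `2`, the second summand is the real form of two
one-dimensional root spaces, on which commutators act trivially. -/
theorem IsGradingElement.lie_derived_eq_zero
    (hneg : ∀ x : 𝔤, x ≠ 0 → killingForm ℝ 𝔤 x x < 0) {γ : H.root} (hγ : coeff b i₀ γ = 2)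
    (huniq : ∀ α, coeff b i₀ α = 2 → α = γ) :
    ∀ W ∈ gradedComponent Z 1, ∀ P ∈ gradingSpace Z 2, ⁅W, P⁆ = 0 := by
  intro W hW P hP
  have hE : eigenspace (ad ℂ (ℂ ⊗[ℝ] 𝔤) (1 ⊗ₜ Z)) (-I * 2) =
      (rootSpace H (γ : H → ℂ)).toSubmodule := by
    rw [← eigenspace_eq_iSup_rootSpace (H := H) _ (fun α => -I * coeff b i₀ α)
      hZ.ad_cartan hZ.ad_root]
    have h1 : ∀ α : H.root, -I * coeff b i₀ α = -I * 2 ↔ α = γ := fun α => by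
      rw [mul_right_inj' (neg_ne_zero.2 Complex.I_ne_zero)]
      exact ⟨huniq α, fun h => h ▸ hγ⟩
    simp only [h1, iSup_iSup_eq_left]
    simp
  have hfin := IsKilling.finrank_rootSpace_eq_one (γ : LieModule.Weight ℂ H (ℂ ⊗[ℝ] 𝔤))
    (LieSubalgebra.isNonZero_coe_root _)
  -- the projection of `2 P` to an eigenspace of `ad Z`
  let p : ℂ ⊗[ℝ] 𝔤 := 1 ⊗ₜ P + I ⊗ₜ ((1 / 2 : ℝ) • ⁅Z, P⁆)
  have hp : ad ℂ (ℂ ⊗[ℝ] 𝔤) (1 ⊗ₜ Z) p = (-I * 2) • p := by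
    have e1 : (1 / 2 : ℝ) • -((2 : ℝ) ^ 2 • P) = (-2 : ℝ) • P := by module
    have e2 : I * (-2 : ℝ) = -I * 2 := by push_cast; ring
    have e3 : -I * 2 * I * (1 / 2 : ℝ) = 1 := by
      push_cast
      linear_combination -Complex.I_mul_I
    rw [map_add, ad_tmul_tmul, ad_tmul_tmul, lie_smul, mem_gradingSpace.1 hP, e1, smul_add,
      TensorProduct.smul_tmul', TensorProduct.smul_tmul', ← TensorProduct.smul_tmul,
      ← TensorProduct.smul_tmul, add_comm]
    simp only [one_mul, smul_eq_mul, mul_one, Complex.real_smul]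
    rw [mul_comm _ I, e2, mul_comm _ (-I * 2 * I), e3]
  -- `𝔨` preserves the eigenspace of `p`, which is a single root space
  have key : ∀ X ∈ gradingSpace Z 0, ∃ k : ℂ, ad ℂ (ℂ ⊗[ℝ] 𝔤) (1 ⊗ₜ X) p = k • p := by
    intro X hX
    rcases eq_or_ne p 0 with h0 | h0
    · exact ⟨0, by rw [h0, map_zero, smul_zero]⟩
    have hp' : p ∈ (rootSpace H (γ : H → ℂ)).toSubmodule := hE ▸ mem_eigenspace_iff.2 hp
    have hXp : ad ℂ (ℂ ⊗[ℝ] 𝔤) (1 ⊗ₜ X) p ∈ (rootSpace H (γ : H → ℂ)).toSubmodule := by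
      rw [← hE, mem_eigenspace_iff, ad_leibniz, hp, ad_tmul_tmul, (mem_gradingSpace_zero hneg).1 hX]
      simp
    obtain ⟨k, hk⟩ := (finrank_eq_one_iff_of_nonzero'
      (⟨p, hp'⟩ : (rootSpace H (γ : H → ℂ)).toSubmodule)
      fun h => h0 (congrArg Subtype.val h)).1 hfin ⟨_, hXp⟩
    exact ⟨k, (congrArg Subtype.val hk).symm⟩
  induction hW using Submodule.span_induction with
  | mem W hW =>
    obtain ⟨X, hX, Y, hY, rfl⟩ := hW
    obtain ⟨k, hk⟩ := key X hX
    obtain ⟨l, hl⟩ := key Y hY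
    have h0 : ad ℂ (ℂ ⊗[ℝ] 𝔤) (1 ⊗ₜ ⁅X, Y⁆) p = 0 := by
      have h1 := ad_leibniz (1 ⊗ₜ X) (1 ⊗ₜ Y) p
      rw [hl, hk, map_smul, map_smul, hk, hl, ad_tmul_tmul, one_mul, smul_comm k l p] at h1
      simpa using h1
    have h2 := congrArg rePart h0
    rw [rePart_ad] at h2
    simpa [p] using h2
  | zero => exact zero_lie P
  | add V W _ _ hV hW => rw [add_lie, hV, hW, add_zero]
  | smul a W _ hW => rw [smul_lie, hW, smul_zero]

end Transfer

/-! ### The classification -/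

section Criterion

variable {n : ℕ} {G : Subgroup (GL (Fin n) ℝ)} {𝔤 : LieSubalgebra ℝ (Matrix (Fin n) (Fin n) ℝ)}

/-- A diagonal metric is naturally reductive if and only if, for some scalar `r`, each component on
which `M` is not `1 / r` commutes with `M`. -/
theorem exists_isNaturallyReductive_iff [LieAlgebra.IsSimple ℝ 𝔤]
    (hneg : ∀ x : 𝔤, x ≠ 0 → killingForm ℝ 𝔤 x x < 0) (hG : IsLieAlgebraOf G 𝔤) {Z : 𝔤}
    (htop : ⨆ i, gradedComponent Z i = ⊤) {m : LinearMap.BilinForm ℝ 𝔤} {M : 𝔤 →ₗ[ℝ] 𝔤}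
    {c : Fin 5 → ℝ} (hM : IsDiagonalOperator Z M c)
    (hm : ∀ X Y, m X Y = -killingForm ℝ 𝔤 (M X) Y) (hc : ∀ i, c i ≠ 0) :
    (∃ L : Subgroup G, IsClosed (L : Set G) ∧ IsNaturallyReductive hG m L) ↔
      ∃ r : ℝ, ∀ i, r * c i = 1 ∨ ∀ V ∈ gradedComponent Z i, CommutesWithAd M V := by
  obtain ⟨N, hMN, hNM⟩ := exists_inverse htop hM hc
  have hsymm := hM.killingForm_symm hneg htop
  simp only [← forall_comm_sub_iff htop hM]
  exact ⟨fun ⟨L, _, h⟩ =>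
      exists_scalar_of_isNaturallyReductive hneg hG m M N hm hsymm hMN hNM L h,
    fun ⟨r, h⟩ => exists_isNaturallyReductive hG m M hm hsymm r h⟩

end Criterion

end NatRed

theorem proposition4p6 {n : ℕ}
    -- a compact connected simple Lie group `G` with Lie algebra `𝔤`
    (G : Subgroup (GL (Fin n) ℝ))
    (_hcompact : IsCompact (G : Set (GL (Fin n) ℝ)))
    (_hconnected : IsConnected (G : Set (GL (Fin n) ℝ)))
    (𝔤 : LieSubalgebra ℝ (Matrix (Fin n) (Fin n) ℝ))
    (hG : NatRed.IsLieAlgebraOf G 𝔤)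
    [LieAlgebra.IsSimple ℝ 𝔤]
    -- a maximal torus `𝔱` with complexification `H`, simple roots `b`, painted simple root `i₀`
    (𝔱 : LieSubalgebra ℝ 𝔤)
    (H : LieSubalgebra ℂ (ℂ ⊗[ℝ] 𝔤)) [H.IsCartanSubalgebra]
    (_hH : H.toSubmodule = 𝔱.toSubmodule.baseChange ℂ)
    (b : (LieAlgebra.IsKilling.rootSystem H).Base) (i₀ : b.support)
    -- the left-invariant metric with parameters `(u₀, u₁, x₁, x₂, x₃)`
    (u₀ u₁ x₁ x₂ x₃ : ℝ)
    (_hu₀ : 0 < u₀) (_hu₁ : 0 < u₁) (_hx₁ : 0 < x₁) (_hx₂ : 0 < x₂) (_hx₃ : 0 < x₃)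
    (m : LinearMap.BilinForm ℝ 𝔤)
    (_hm : NatRed.IsDiagonalMetric b i₀ m ![u₀, u₁, x₁, x₂, x₃]) :
    -- `G₂(2)`: the short simple root is painted
    (NatRed.IsPaintedDiagram b i₀ CartanMatrix.G₂ 1 →
      ((∃ L : Subgroup G, IsClosed (L : Set G) ∧ NatRed.IsNaturallyReductive hG m L) ↔
        ((u₀ = x₂ ∧ x₁ = x₃) ∨
          (u₀ = u₁ ∧ u₁ = x₃ ∧ x₁ = x₂) ∨
          (x₁ = x₂ ∧ x₂ = x₃)))) ∧
    -- `E₈(8)`: the simple root at the end of the short arm is painted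
    (NatRed.IsPaintedDiagram b i₀ CartanMatrix.E₈ 1 →
      ((∃ L : Subgroup G, IsClosed (L : Set G) ∧ NatRed.IsNaturallyReductive hG m L) ↔
        ((u₀ = u₁ ∧ u₁ = x₂ ∧ x₁ = x₃) ∨
          (u₀ = u₁ ∧ u₁ = x₃ ∧ x₁ = x₂) ∨
          (x₁ = x₂ ∧ x₂ = x₃)))) := by
  have hneg := NatRed.killingForm_neg _hcompact hG
  have hc : ∀ i, ![u₀, u₁, x₁, x₂, x₃] i ≠ 0 := by
    simp [Fin.forall_fin_succ, _hu₀.ne', _hu₁.ne', _hx₁.ne', _hx₂.ne', _hx₃.ne']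
  -- the degree bound yields the grading element, and with it the algebraic criterion
  have key : NatRed.IsDegreeThree b i₀ → ∃ (Z : 𝔤) (M : 𝔤 →ₗ[ℝ] 𝔤),
      NatRed.IsGradingElement b i₀ Z ∧ NatRed.gradingSpace Z 0 ⊔ NatRed.gradingSpace Z 1 ⊔
        NatRed.gradingSpace Z 2 ⊔ NatRed.gradingSpace Z 3 = ⊤ ∧
      NatRed.IsDiagonalOperator Z M ![u₀, u₁, x₁, x₂, x₃] ∧
      ((∃ L : Subgroup G, IsClosed (L : Set G) ∧ NatRed.IsNaturallyReductive hG m L) ↔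
        ∃ r : ℝ, ∀ i, r * ![u₀, u₁, x₁, x₂, x₃] i = 1 ∨
          ∀ V ∈ NatRed.gradedComponent Z i, NatRed.CommutesWithAd M V) := fun hb => by
    obtain ⟨Z, hZ⟩ := NatRed.exists_isGradingElement hneg _hH fun α =>
      (hb.bound α).imp fun _ h => h.1
    have htop := hZ.sup_gradingSpace_eq_top hb.bound
    have htop' := NatRed.iSup_gradedComponent_eq_top hneg htop
    have hm := _hm
    rw [NatRed.IsDiagonalMetric, hZ.component_eq] at hm
    obtain ⟨M, hM, hmM⟩ := NatRed.exists_diagonalOperator hneg htop' m hm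
    exact ⟨Z, M, hZ, htop, hM,
      NatRed.exists_isNaturallyReductive_iff hneg hG htop' hM hmM hc⟩
  constructor
  · rintro ⟨e, hA, h0⟩
    obtain ⟨hb, h3, huniq⟩ := NatRed.isDegreeThree_G₂ hA h0
    obtain ⟨Z, M, hZ, htop, hM, hiff⟩ := key hb
    obtain ⟨γ, hγ, -⟩ := hb.pairing_two
    rw [hiff]
    exact NatRed.exists_scalar_iff_of_trivial hneg htop hM (hZ.exists_lie_one_three hb)
      (hZ.exists_lie_one_two hb) (hZ.exists_lie_derived (by simpa using h3)) hc
      (hZ.lie_derived_eq_zero hneg hγ fun α hα => huniq α γ hα hγ)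
  · rintro ⟨e, hA, h0⟩
    obtain ⟨hb, h2, h3⟩ := NatRed.isDegreeThree_E₈ hA h0
    obtain ⟨Z, M, hZ, htop, hM, hiff⟩ := key hb
    rw [hiff]
    exact NatRed.exists_scalar_iff_of_nontrivial hneg htop hM (hZ.exists_lie_one_three hb)
      (hZ.exists_lie_one_two hb) (hZ.exists_lie_derived (by simpa using h3)) hc
      (hZ.exists_lie_derived (by simpa using h2))
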